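/- Let $d,q\ge 1$. To each site of $\mathbb Z^d$ associate the Hilbert space $\mathbb C^q$. For a finite $\Lambda\subset\mathbb Z^d$ let $\mathfrak U_\Lambda$ be the algebra of linear operators on $\bigotimes_{x\in\Lambda}\mathbb C^q$ with the operator norm $\|\cdot\|_\infty$, with $\mathfrak U_{\Lambda'}\subseteq\mathfrak U_{\Lambda}$ canonically for $\Lambda'\subseteq\Lambda$. Let $\mathfrak U$ be the norm completion of $\bigcup_\Lambda\mathfrak U_\Lambda$ (the quasi-local algebra) and let $\tau_x$ ($x\in\mathbb Z^d$) be its translation automorphisms. A state is a positive linear functional $\rho$ on $\mathfrak U$ with $\rho(\mathbb I)=1$; it is translation invariant if $\rho\circ\tau_x=\rho$ for all $x$. Denote by $\rho_\Lambda$ the density matrix of the restriction of $\rho$ to $\mathfrak U_\Lambda$. For $a\in\mathbb N_+^d$ let $\Lambda_a=\{x\in\mathbb Z^d:-a\le x<a\}$ (componentwise), and let $a\to\infty$ mean that all components tend to infinity. For a traceless self-adjoint $\Delta\in\mathfrak U_\Lambda$ let $$\|\Delta\|_{W_1}=\tfrac12\min\Big\{\sum_{x\in\Lambda}\|\Delta^{(x)}\|_1:\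 \Delta^{(x)}\in\mathfrak U_\Lambda \text{ self-adjoint and traceless},\ \mathrm{Tr}_x\Delta^{(x)}=0,\ \sum_{x\in\Lambda}\Delta^{(x)}=\Delta\Big\},$$ where $\|A\|_1=\mathrm{Tr}\sqrt{A^\dagger A}$ and $\mathrm{Tr}_x$ is the partial trace over the site $x$. Let $S(\rho)=-\mathrm{Tr}[\rho\ln\rho]$ and $S(\rho\|\sigma)=\mathrm{Tr}[\rho(\ln\rho-\ln\sigma)]$ for density matrices (with $\sigma$ of full rank). Let $r>0$ and let $\Phi\in\mathcal B^r$ be a translation-invariant interaction, i.e. a family of self-adjoint $\Phi(\Lambda)\in\mathfrak U_\Lambda$, indexed by the finite $\Lambda\subset\mathbb Z^d$, with $\Phi(\Lambda+x)=\tau_x(\Phi(\Lambda))$ for all $x\in\mathbb Z^d$ and $\sum_{\Lambda\ni 0}e^{r(|\Lambda|-1)}\|\Phi(\Lambda)\|_\infty<\infty$. Put $H_\Lambda=\sum_{X\subseteq\Lambda}\Phi(X)$, $\omega^\Phi_\Lambda=e^{-H_\Lambda}/\mathrm{Tr}\,e^{-H_\Lambda}$ and $E_\Phi=\sum_{\Lambda\ni0}\Phi(\Lambda)/|\Lambda|\in\mathfrak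 U$. For a translation-invariant state $\rho$ put $$s(\rho)=\lim_{a\to\infty}\frac{S(\rho_{\Lambda_a})}{|\Lambda_a|},\qquad s(\rho\|\Phi)=\lim_{a\to\infty}\frac{S(\rho_{\Lambda_a}\|\omega^\Phi_{\Lambda_a})}{|\Lambda_a|},\qquad w_1(\rho,\Phi)=\limsup_{a\to\infty}\frac{\|\rho_{\Lambda_a}-\omega^\Phi_{\Lambda_a}\|_{W_1}}{|\Lambda_a|}$$ (the two limits exist). A translation-invariant state is an equilibrium state of $\Phi$ if it attains $\sup_\rho\,(s(\rho)-\rho(E_\Phi))$, the supremum being over all translation-invariant states; a translation-invariant state $\omega$ is a $w_1$-Gibbs state of $\Phi$ if $w_1(\omega,\Phi)=0$. **Proposition.** Suppose that there is $c>0$ such that, for every translation-invariant state $\rho$, $$w_1(\rho,\Phi)^2\le\frac c2\,s(\rho\|\Phi).$$ Then $\Phi$ has exactly one equilibrium state, and this state is a $w_1$-Gibbs state of $\Phi$, in fact the only one. -/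

import Mathlib

open scoped ComplexOrder
open Filter

noncomputable section

namespace QuantumSpin

/-! ## Configurations and the observables of finite regions -/

/-- The lattice `ℤ^d`. -/
abbrev Site (d : ℕ) : Type := Fin d → ℤ

/-- Configurations of the whole lattice; they label the canonical product basis. -/
abbrev Config (d q : ℕ) : Type := Site d → Fin q

/-- The algebra of the linear operators on `⨂_{x ∈ Λ} ℂ^q`, as matrices in the canonical product
basis, which is labelled by the configurations `Λ → Fin q`. -/
abbrev LocalObs (d q : ℕ) (Λ : Finset (Site d)) : Type :=
  Matrix (Λ → Fin q) (Λ → Fin q) ℂ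

variable {d q : ℕ}

/-- The operator norm on the observables of a finite region. -/
def opNorm {Λ : Finset (Site d)} (A : LocalObs d q Λ) : ℝ :=
  ‖Matrix.toEuclideanCLM (𝕜 := ℂ) A‖

/-- The canonical inclusion `A ↦ A ⊗ 1` of the observables of `X` into those of `Λ ⊇ X`. -/
def incl {X Λ : Finset (Site d)} (h : X ⊆ Λ) (A : LocalObs d q X) : LocalObs d q Λ :=
  Matrix.of fun s t =>
    if ∀ y : Λ, y.1 ∉ X → s y = t y then
      A (fun y => s ⟨y.1, h y.2⟩) (fun y => t ⟨y.1, h y.2⟩)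
    else 0

/-- The region `Λ + x`. -/
def shiftRegion (x : Site d) (Λ : Finset (Site d)) : Finset (Site d) :=
  Λ.map (Equiv.addRight x).toEmbedding

theorem add_mem_shiftRegion {x : Site d} {Λ : Finset (Site d)} {y : Site d} (hy : y ∈ Λ) :
    y + x ∈ shiftRegion x Λ :=
  Finset.mem_map.2 ⟨y, hy, rfl⟩

/-- The translation by `x` of local observables, from the region `Λ` to the region `Λ + x`. -/
def shiftObs (x : Site d) {Λ : Finset (Site d)} (A : LocalObs d q Λ) :
    LocalObs d q (shiftRegion x Λ) :=
  Matrix.of fun s t =>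
    A (fun y => s ⟨y.1 + x, add_mem_shiftRegion y.2⟩)
      (fun y => t ⟨y.1 + x, add_mem_shiftRegion y.2⟩)

/-! ## The quasi-local algebra

The quasi-local algebra is realized inside the bounded operators on `ℓ²(Config d q)`.  An
observable `A` of a finite region `Λ` acts on the coordinates in `Λ` and leaves the other ones
unchanged; this is an isometric unital star-homomorphism that is compatible with the inclusions
(`norm_localEmb`, `localEmb_incl`), so the norm closure of the union of the images is
the completion of the strictly local algebra. -/

/-- The Hilbert space of the square-summable functions of the configurations. -/
abbrev Hil (d q : ℕ) : Type := lp (fun _ : Config d q => ℂ) 2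

/-- The unitary operator `ψ ↦ ψ ∘ e` for a bijection `e` of the configurations. -/
def permIso (e : Config d q ≃ Config d q) : Hil d q ≃ₗᵢ[ℂ] Hil d q where
  toFun ψ := ⟨fun s => ψ (e s), memℓp_gen (e.summable_iff.2 ((lp.memℓp ψ).summable (by norm_num)))⟩
  invFun ψ := ⟨fun s => ψ (e.symm s),
    memℓp_gen (e.symm.summable_iff.2 ((lp.memℓp ψ).summable (by norm_num)))⟩
  map_add' ψ φ := by ext s; rfl
  map_smul' c ψ := by ext s; rfl
  left_inv ψ := by ext s; exact congrArg ψ (e.apply_symm_apply s)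
  right_inv ψ := by ext s; exact congrArg ψ (e.symm_apply_apply s)
  norm_map' ψ := by
    rw [lp.norm_eq_tsum_rpow (by norm_num), lp.norm_eq_tsum_rpow (by norm_num)]
    congr 1
    exact e.tsum_eq (fun s => ‖ψ s‖ ^ (2 : ENNReal).toReal)

/-- The unitary operator `ψ ↦ ψ ∘ e` as a bounded operator; its inverse and adjoint is the operator
of `e.symm`. -/
def permOp (e : Config d q ≃ Config d q) : Hil d q →L[ℂ] Hil d q :=
  ((permIso e).toContinuousLinearEquiv : Hil d q ≃L[ℂ] Hil d q)

theorem permOp_apply (e : Config d q ≃ Config d q) (ψ : Hil d q) (s : Config d q) :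
    permOp e ψ s = ψ (e s) := rfl

/-- The restriction of a configuration to a finite region. -/
def restr (Λ : Finset (Site d)) (s : Config d q) : Λ → Fin q := fun y => s y

/-- The configuration that agrees with `t` in `Λ` and with `s` outside `Λ`. -/
def glue {Λ : Finset (Site d)} (t : Λ → Fin q) (s : Config d q) : Config d q :=
  fun y => if h : y ∈ Λ then t ⟨y, h⟩ else s y

theorem restr_glue {Λ : Finset (Site d)} (t : Λ → Fin q) (s : Config d q) :
    restr Λ (glue t s) = t := by
  funext y
  simp [restr, glue]

theorem glue_glue {Λ : Finset (Site d)} (t u : Λ → Fin q) (s : Config d q) :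
    glue t (glue u s) = glue t s := by
  funext y
  by_cases h : y ∈ Λ <;> simp [glue, h]

theorem glue_restr (Λ : Finset (Site d)) (s : Config d q) : glue (restr Λ s) s = s := by
  funext y
  simp [restr, glue]

/-- The bijection of the configurations that exchanges the local configurations `a` and `b`. -/
def swapConfig {Λ : Finset (Site d)} (a b : Λ → Fin q) : Config d q ≃ Config d q where
  toFun s := glue (Equiv.swap a b (restr Λ s)) s
  invFun s := glue (Equiv.swap a b (restr Λ s)) s
  left_inv s := by simp [restr_glue, glue_glue, glue_restr]
  right_inv s := by simp [restr_glue, glue_glue, glue_restr]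

theorem swapConfig_apply {Λ : Finset (Site d)} (a b : Λ → Fin q) (s : Config d q) :
    swapConfig a b s = glue (Equiv.swap a b (restr Λ s)) s := rfl

/-- The projection onto the functions supported on the configurations that agree with `a`. -/
def cutoff {Λ : Finset (Site d)} (a : Λ → Fin q) : Hil d q →L[ℂ] Hil d q :=
  LinearMap.mkContinuous
    { toFun := fun ψ => ⟨fun s => if restr Λ s = a then ψ s else 0,
        (lp.memℓp ψ).mono' (by intro s; split_ifs <;> simp)⟩
      map_add' := fun ψ φ => by
        ext s
        change (if restr Λ s = a then ψ s + φ s else 0)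
          = (if restr Λ s = a then ψ s else 0) + (if restr Λ s = a then φ s else 0)
        split_ifs <;> simp
      map_smul' := fun c ψ => by
        ext s
        change (if restr Λ s = a then c * ψ s else 0) = c * (if restr Λ s = a then ψ s else 0)
        split_ifs <;> simp } 1
    (fun ψ => by
      rw [one_mul]
      refine lp.norm_mono (by norm_num) ?_
      intro s
      change ‖(if restr Λ s = a then ψ s else 0 : ℂ)‖ ≤ ‖ψ s‖
      split_ifs <;> simp)

theorem cutoff_apply {Λ : Finset (Site d)} (a : Λ → Fin q) (ψ : Hil d q) (s : Config d q) :
    cutoff a ψ s = if restr Λ s = a then ψ s else 0 := rfl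

/-- The action of an observable of `Λ` on the Hilbert space of all the configurations,
`(A ψ)(s) = ∑ t, A (s|Λ) t * ψ (t in Λ, s outside Λ)`; see `localAction_apply`. -/
def localAction {Λ : Finset (Site d)} (A : LocalObs d q Λ) : Hil d q →L[ℂ] Hil d q :=
  ∑ a, ∑ b, A a b • (cutoff a * permOp (swapConfig a b))

theorem localAction_apply {Λ : Finset (Site d)} (A : LocalObs d q Λ) (ψ : Hil d q)
    (s : Config d q) :
    localAction A ψ s = ∑ t, A (restr Λ s) t * ψ (glue t s) := by
  have h : localAction A ψ s = ∑ a, ∑ b,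
      A a b * (if restr Λ s = a then ψ (swapConfig a b s) else 0) := by
    simp only [localAction, sum_apply, lp.coeFn_sum, Finset.sum_apply]
    rfl
  rw [h, Finset.sum_eq_single (restr Λ s)]
  · refine Finset.sum_congr rfl fun b _ => ?_
    simp [swapConfig_apply]
  · intro a _ ha
    simp [Ne.symm ha]
  · simp

theorem hil_inner (φ ψ : Hil d q) : inner ℂ φ ψ = ∑' s, inner ℂ (φ s) (ψ s) :=
  lp.inner_eq_tsum φ ψ

theorem cutoff_adjoint {Λ : Finset (Site d)} (a : Λ → Fin q) :
    star (cutoff a : Hil d q →L[ℂ] Hil d q) = cutoff a := by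
  symm
  rw [ContinuousLinearMap.star_eq_adjoint, ContinuousLinearMap.eq_adjoint_iff]
  intro φ ψ
  rw [hil_inner, hil_inner]
  refine tsum_congr fun s => ?_
  rw [cutoff_apply, cutoff_apply]
  split_ifs <;> simp

theorem permOp_adjoint (e : Config d q ≃ Config d q) :
    star (permOp e : Hil d q →L[ℂ] Hil d q) = permOp e.symm := by
  symm
  rw [ContinuousLinearMap.star_eq_adjoint, ContinuousLinearMap.eq_adjoint_iff]
  intro φ ψ
  rw [hil_inner, hil_inner, ← e.tsum_eq]
  refine tsum_congr fun s => ?_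
  change inner ℂ (φ (e.symm (e s))) (ψ (e s)) = inner ℂ (φ s) (ψ (e s))
  rw [e.symm_apply_apply]

theorem localAction_star {Λ : Finset (Site d)} (A : LocalObs d q Λ) :
    localAction (star A) = star (localAction A) := by
  rw [localAction, localAction, star_sum, Finset.sum_comm]
  refine Finset.sum_congr rfl fun a _ => ?_
  rw [star_sum]
  refine Finset.sum_congr rfl fun b _ => ?_
  rw [star_smul, Matrix.star_apply]
  congr 1
  rw [star_mul, cutoff_adjoint, permOp_adjoint]
  ext ψ s
  change (if restr Λ s = b then ψ (swapConfig b a s) else 0)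
    = (if restr Λ (swapConfig a b s) = a then ψ (swapConfig a b s) else 0)
  rw [swapConfig_apply, swapConfig_apply, restr_glue, Equiv.swap_comm b a]
  congr 1
  rw [Equiv.swap_apply_eq_iff, Equiv.swap_apply_left]

/-- The canonical embedding of the observables of a finite region. -/
def localEmb (Λ : Finset (Site d)) : LocalObs d q Λ →⋆ₐ[ℂ] (Hil d q →L[ℂ] Hil d q) where
  toFun A := localAction A
  map_one' := by
    ext ψ s
    rw [localAction_apply]
    simp [Matrix.one_apply, glue_restr]
  map_mul' A B := by
    ext ψ s
    change _ = localAction A (localAction B ψ) s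
    simp only [localAction_apply, restr_glue, glue_glue, Matrix.mul_apply, Finset.sum_mul,
      Finset.mul_sum]
    rw [Finset.sum_comm]
    simp only [mul_assoc]
  map_zero' := by simp [localAction]
  map_add' A B := by simp [localAction, add_smul, Finset.sum_add_distrib]
  commutes' c := by
    ext ψ s
    rw [localAction_apply]
    simp [Matrix.algebraMap_matrix_apply, glue_restr]
  map_star' A := localAction_star A

theorem localEmb_apply {Λ : Finset (Site d)} (A : LocalObs d q Λ) (ψ : Hil d q)
    (s : Config d q) :
    localEmb Λ A ψ s = ∑ t, A (restr Λ s) t * ψ (glue t s) :=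
  localAction_apply A ψ s

theorem localEmb_injective [NeZero q] (Λ : Finset (Site d)) :
    Function.Injective (localEmb Λ : LocalObs d q Λ → _) := by
  classical
  intro A B h
  ext a b
  have key : ∀ C : LocalObs d q Λ,
      localEmb Λ C (lp.single 2 (glue b (fun _ => 0)) 1) (glue a (fun _ => 0)) = C a b := by
    intro C
    rw [localEmb_apply, Finset.sum_eq_single b]
    · simp [restr_glue, glue_glue]
    · intro t _ ht
      have : glue t (glue a fun _ => (0 : Fin q)) ≠ glue b (fun _ => (0 : Fin q)) := by
        intro h'
        apply ht
        rw [← restr_glue t (glue a fun _ => (0 : Fin q)), h', restr_glue]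
      rw [lp.single_apply_ne _ _ _ this, mul_zero]
    · simp
  rw [← key A, ← key B, h]

/-- The embedding of local observables is isometric for the operator norms. -/
theorem norm_localEmb [NeZero q] {Λ : Finset (Site d)} (A : LocalObs d q Λ) :
    ‖localEmb Λ A‖ = opNorm A := by
  let f : (EuclideanSpace ℂ (Λ → Fin q) →L[ℂ] EuclideanSpace ℂ (Λ → Fin q)) →⋆ₐ[ℂ]
      (Hil d q →L[ℂ] Hil d q) :=
    (localEmb Λ).comp (Matrix.toEuclideanCLM (n := Λ → Fin q) (𝕜 := ℂ)).symm
  have hf : Function.Injective f :=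
    (localEmb_injective Λ).comp (Matrix.toEuclideanCLM (n := Λ → Fin q) (𝕜 := ℂ)).symm.injective
  have := NonUnitalStarAlgHom.norm_map f hf (Matrix.toEuclideanCLM (𝕜 := ℂ) A)
  rw [opNorm, ← this]
  simp [f]

/-- The embeddings are compatible with the inclusions of the regions. -/
theorem localEmb_incl {X Λ : Finset (Site d)} (h : X ⊆ Λ) (A : LocalObs d q X) :
    localEmb Λ (incl h A) = localEmb X A := by
  ext ψ s
  rw [localEmb_apply, localEmb_apply]
  symm
  refine Finset.sum_of_injOn (fun t => restr Λ (glue t s)) ?_ (fun _ _ => Finset.mem_univ _)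
    ?_ ?_
  · intro t _ t' _ htt
    funext y
    have := congrFun htt ⟨y.1, h y.2⟩
    simpa [restr, glue] using this
  · intro u _ hu
    rw [incl, Matrix.of_apply, if_neg, zero_mul]
    intro hy
    apply hu
    refine ⟨fun y => u ⟨y.1, h y.2⟩, Finset.mem_coe.2 (Finset.mem_univ _), ?_⟩
    funext y
    by_cases hyX : y.1 ∈ X
    · simp [restr, glue, hyX]
    · have := hy y hyX
      simp only [restr] at this
      simp [restr, glue, hyX, this]
  · intro t _
    have hg : glue (restr Λ (glue t s)) s = glue t s := by
      funext y
      by_cases hy : y ∈ Λ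
      · simp [glue, restr, hy]
      · have hyX : y ∉ X := fun hX => hy (h hX)
        simp [glue, hy, hyX]
    rw [hg, incl, Matrix.of_apply, if_pos]
    · congr 2
      funext y
      simp [restr, glue]
    · intro y hy
      simp [restr, glue, hy]

variable (d q) in
/-- The strictly local algebra: the union of the observables of the finite regions. -/
def strictlyLocal : StarSubalgebra ℂ (Hil d q →L[ℂ] Hil d q) :=
  ⨆ Λ : Finset (Site d), (localEmb Λ).range

theorem mem_strictlyLocal {T : Hil d q →L[ℂ] Hil d q} :
    T ∈ strictlyLocal d q ↔ ∃ (Λ : Finset (Site d)) (A : LocalObs d q Λ), localEmb Λ A = T := by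
  have hmono : Monotone fun Λ : Finset (Site d) =>
      (localEmb Λ : LocalObs d q Λ →⋆ₐ[ℂ] _).range := by
    rintro X Λ h _ ⟨A, rfl⟩
    exact ⟨incl h A, localEmb_incl h A⟩
  rw [strictlyLocal, ← SetLike.mem_coe, StarSubalgebra.coe_iSup_of_directed hmono.directed_le,
    Set.mem_iUnion]
  rfl

variable (d q) in
/-- The quasi-local algebra of the spin lattice: the norm closure of the strictly local one. -/
def quasiLocal : StarSubalgebra ℂ (Hil d q →L[ℂ] Hil d q) :=
  (strictlyLocal d q).topologicalClosure

theorem localEmb_mem (Λ : Finset (Site d)) (A : LocalObs d q Λ) :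
    localEmb Λ A ∈ quasiLocal d q :=
  StarSubalgebra.le_topologicalClosure _ (mem_strictlyLocal.2 ⟨Λ, A, rfl⟩)

/-- A local observable as an element of the quasi-local algebra. -/
def toQL {Λ : Finset (Site d)} (A : LocalObs d q Λ) : quasiLocal d q :=
  ⟨localEmb Λ A, localEmb_mem Λ A⟩

/-! ## Translations -/

/-- The bijection `s ↦ s (· + x)` of the configurations. -/
def shiftConfig (x : Site d) : Config d q ≃ Config d q :=
  (Equiv.addRight (-x)).arrowCongr (Equiv.refl (Fin q))

theorem shiftConfig_apply (x : Site d) (s : Config d q) (y : Site d) :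
    shiftConfig x s y = s (y + x) := by
  simp [shiftConfig, Equiv.arrowCongr]

/-- Conjugation of operators by the unitary that translates the configurations by `x`. -/
def shiftConj (x : Site d) (T : Hil d q →L[ℂ] Hil d q) : Hil d q →L[ℂ] Hil d q :=
  permOp (shiftConfig x) * T * permOp (shiftConfig x).symm

/-- The translation sends the observable `A` of `Λ` to its translate in `Λ + x`. -/
theorem shiftConj_localEmb (x : Site d) {Λ : Finset (Site d)} (A : LocalObs d q Λ) :
    shiftConj x (localEmb Λ A) = localEmb (shiftRegion x Λ) (shiftObs x A) := by
  have hmem : ∀ y, y ∈ shiftRegion x Λ ↔ y - x ∈ Λ := by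
    intro y
    simp only [shiftRegion, Finset.mem_map, Equiv.coe_toEmbedding, Equiv.coe_addRight]
    constructor
    · rintro ⟨z, hz, rfl⟩
      simpa using hz
    · intro h
      exact ⟨y - x, h, by simp⟩
  ext ψ s
  change localEmb Λ A (permOp (shiftConfig x).symm ψ) (shiftConfig x s) = _
  rw [localEmb_apply, localEmb_apply]
  refine Finset.sum_bij' (fun t _ => fun y => t ⟨y.1 - x, (hmem y.1).1 y.2⟩)
    (fun u _ => fun y => u ⟨y.1 + x, add_mem_shiftRegion y.2⟩)
    (fun _ _ => Finset.mem_univ _) (fun _ _ => Finset.mem_univ _) ?_ ?_ ?_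
  · intro t _
    simp
  · intro u _
    simp
  · intro t _
    rw [permOp_apply, shiftObs, Matrix.of_apply]
    congr 2
    · funext y
      simp [restr, shiftConfig_apply]
    · simp
    · refine congrArg ψ ?_
      rw [Equiv.symm_apply_eq]
      funext y
      rw [shiftConfig_apply]
      by_cases hy : y ∈ Λ
      · simp [glue, hy, add_mem_shiftRegion hy]
      · have : y + x ∉ shiftRegion x Λ := fun h => hy (by simpa using (hmem _).1 h)
        simp [glue, hy, this, shiftConfig_apply]

theorem shiftConj_mem (x : Site d) {T : Hil d q →L[ℂ] Hil d q} (hT : T ∈ quasiLocal d q) :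
    shiftConj x T ∈ quasiLocal d q := by
  have hc : Continuous (shiftConj x : (Hil d q →L[ℂ] Hil d q) → _) := by
    unfold shiftConj
    fun_prop
  refine map_mem_closure hc hT ?_
  intro S hS
  obtain ⟨Λ, A, rfl⟩ := mem_strictlyLocal.1 hS
  rw [shiftConj_localEmb]
  exact mem_strictlyLocal.2 ⟨_, _, rfl⟩

/-- The translation automorphism `τ_x` of the quasi-local algebra. -/
def translate (x : Site d) (A : quasiLocal d q) : quasiLocal d q :=
  ⟨shiftConj x A, shiftConj_mem x A.2⟩

/-! ## States -/

variable (d q) in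
/-- The states of the spin lattice: the normalized positive linear functionals on the quasi-local
algebra. -/
structure State where
  toLin : quasiLocal d q →ₗ[ℂ] ℂ
  nonneg : ∀ A : quasiLocal d q, 0 ≤ toLin (star A * A)
  map_one : toLin 1 = 1

/-- Invariance under all the translations. -/
def State.IsInvariant (ρ : State d q) : Prop :=
  ∀ (x : Site d) (A : quasiLocal d q), ρ.toLin (translate x A) = ρ.toLin A

/-- The density matrix of the restriction of a state to the observables of `Λ`; its defining
property is `State.trace_marginal_mul`. -/
def State.marginal (ρ : State d q) (Λ : Finset (Site d)) : LocalObs d q Λ :=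
  Matrix.of fun a b => ρ.toLin (toQL (Matrix.single b a 1))

theorem State.trace_marginal_mul (ρ : State d q) (Λ : Finset (Site d)) (A : LocalObs d q Λ) :
    (ρ.marginal Λ * A).trace = ρ.toLin (toQL A) := by
  let f : LocalObs d q Λ →ₗ[ℂ] quasiLocal d q :=
    { toFun := toQL
      map_add' := fun A B => Subtype.ext (map_add (localEmb Λ) A B)
      map_smul' := fun c A => Subtype.ext (map_smul (localEmb Λ) c A) }
  have hA : toQL A = ∑ b, ∑ a, A b a • toQL (Matrix.single b a (1 : ℂ)) := by
    change f A = ∑ b, ∑ a, A b a • f (Matrix.single b a (1 : ℂ))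
    conv_lhs => rw [Matrix.matrix_eq_sum_single A]
    simp only [map_sum, ← map_smul, Matrix.smul_single, smul_eq_mul, mul_one]
  rw [hA]
  simp only [Matrix.trace, Matrix.diag, Matrix.mul_apply, State.marginal, Matrix.of_apply,
    map_sum, map_smul, smul_eq_mul]
  rw [Finset.sum_comm]
  simp only [mul_comm]

/-! ## Entropies and the `W₁` norm of finite systems -/

section Finite

variable {n : Type*} [Fintype n] [DecidableEq n]

/-- The von Neumann entropy `-Tr[ρ ln ρ]` (with `0 ln 0 = 0`). -/
def entropy (ρ : Matrix n n ℂ) : ℝ :=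
  -(ρ * cfc Real.log ρ).trace.re

/-- The relative entropy `Tr[ρ (ln ρ - ln σ)]`, for `σ` of full rank. -/
def relEntropy (ρ σ : Matrix n n ℂ) : ℝ :=
  (ρ * (cfc Real.log ρ - cfc Real.log σ)).trace.re

/-- The Gibbs state `e^{-H} / Tr e^{-H}`. -/
def gibbs (H : Matrix n n ℂ) : Matrix n n ℂ :=
  (NormedSpace.exp (-H)).trace⁻¹ • NormedSpace.exp (-H)

/-- The trace norm `Tr √(A† A)`. -/
def traceNorm (A : Matrix n n ℂ) : ℝ :=
  (cfc Real.sqrt (A.conjTranspose * A)).trace.re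

variable {ι : Type*} [Fintype ι] [DecidableEq ι]

/-- The partial trace over the spin at the site `x`. -/
def traceSite (x : ι) (A : Matrix (ι → Fin q) (ι → Fin q) ℂ) :
    Matrix ({y // y ≠ x} → Fin q) ({y // y ≠ x} → Fin q) ℂ :=
  Matrix.of fun s t => ∑ j : Fin q,
    A ((Equiv.funSplitAt x (Fin q)).symm (j, s)) ((Equiv.funSplitAt x (Fin q)).symm (j, t))

/-- The quantum `W₁` norm of a traceless self-adjoint operator of a finite spin system. -/
def W1norm (D : Matrix (ι → Fin q) (ι → Fin q) ℂ) : ℝ :=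
  sInf {w : ℝ | ∃ E : ι → Matrix (ι → Fin q) (ι → Fin q) ℂ,
    (∀ x, (E x).IsHermitian ∧ (E x).trace = 0 ∧ traceSite x (E x) = 0) ∧
    ∑ x, E x = D ∧ w = (1 / 2) * ∑ x, traceNorm (E x)}

end Finite

/-! ## Interactions and equilibrium states -/

variable (d q) in
/-- An interaction: a self-adjoint observable for each finite region. -/
structure Interaction where
  term : (Λ : Finset (Site d)) → LocalObs d q Λ
  isHermitian : ∀ Λ, (term Λ).IsHermitian

/-- Membership in the space `B^r`: translation invariance and
`∑_{Λ ∋ 0} e^{r (|Λ| - 1)} ‖Φ(Λ)‖ < ∞`. -/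
def Interaction.MemB (Φ : Interaction d q) (r : ℝ) : Prop :=
  (∀ (x : Site d) (Λ : Finset (Site d)), Φ.term (shiftRegion x Λ) = shiftObs x (Φ.term Λ)) ∧
  Summable fun Λ : {Λ : Finset (Site d) // 0 ∈ Λ} =>
    Real.exp (r * ((Λ.1.card : ℝ) - 1)) * opNorm (Φ.term Λ.1)

/-- The local Hamiltonian with open boundary conditions. -/
def Interaction.hamiltonian (Φ : Interaction d q) (Λ : Finset (Site d)) : LocalObs d q Λ :=
  ∑ X ∈ Λ.powerset.attach, incl (Finset.mem_powerset.1 X.2) (Φ.term X.1)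

/-- The local Gibbs state with open boundary conditions. -/
def Interaction.localGibbs (Φ : Interaction d q) (Λ : Finset (Site d)) : LocalObs d q Λ :=
  gibbs (Φ.hamiltonian Λ)

/-- The specific energy observable `∑_{Λ ∋ 0} Φ(Λ) / |Λ|`. -/
def Interaction.energyObs (Φ : Interaction d q) : quasiLocal d q :=
  ∑' Λ : {Λ : Finset (Site d) // 0 ∈ Λ}, (Λ.1.card : ℂ)⁻¹ • toQL (Φ.term Λ.1)

/-- The box `{x | -a ≤ x < a}`. -/
def box (a : Fin d → ℕ) : Finset (Site d) :=
  Fintype.piFinset fun i => Finset.Ico (-(a i : ℤ)) (a i : ℤ)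

/-- The specific entropy `lim_{a → ∞} S(ρ_{Λ_a}) / |Λ_a|` of a translation-invariant state
(the sequence is bounded and converges, so that the upper limit is the limit). -/
def specificEntropy (ρ : State d q) : ℝ :=
  limsup (fun a : Fin d → ℕ => entropy (ρ.marginal (box a)) / ((box a).card : ℝ)) atTop

/-- The specific relative entropy `lim_{a → ∞} S(ρ_{Λ_a} ‖ ω^Φ_{Λ_a}) / |Λ_a|` between a
translation-invariant state and an interaction (the limit exists, as above). -/
def specificRelEntropy (ρ : State d q) (Φ : Interaction d q) : ℝ :=
  limsup (fun a : Fin d → ℕ =>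
    relEntropy (ρ.marginal (box a)) (Φ.localGibbs (box a)) / ((box a).card : ℝ)) atTop

/-- The specific quantum `W₁` distance between a state and an interaction,
`limsup_{a → ∞} ‖ρ_{Λ_a} - ω^Φ_{Λ_a}‖_{W₁} / |Λ_a|`. -/
def w1 (ρ : State d q) (Φ : Interaction d q) : ℝ :=
  limsup (fun a : Fin d → ℕ =>
    W1norm (ρ.marginal (box a) - Φ.localGibbs (box a)) / ((box a).card : ℝ)) atTop

/-- Equilibrium states: the translation-invariant states that attain
`sup_ρ (s(ρ) - ρ(E_Φ))` over the translation-invariant states. -/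
def IsEquilibrium (Φ : Interaction d q) (ω : State d q) : Prop :=
  ω.IsInvariant ∧ ∀ ρ : State d q, ρ.IsInvariant →
    specificEntropy ρ - (ρ.toLin Φ.energyObs).re ≤
      specificEntropy ω - (ω.toLin Φ.energyObs).re

/-- The `w₁`-Gibbs states of an interaction. -/
def IsW1Gibbs (Φ : Interaction d q) (ω : State d q) : Prop :=
  ω.IsInvariant ∧ w1 ω Φ = 0

/-- The transportation-cost inequality with constant `c`. -/
def SatisfiesTCI (Φ : Interaction d q) (c : ℝ) : Prop :=
  ∀ ρ : State d q, ρ.IsInvariant → w1 ρ Φ ^ 2 ≤ c / 2 * specificRelEntropy ρ Φ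

end QuantumSpin

end

noncomputable section

namespace QuantumSpin

/-! ### Functions of Hermitian matrices -/

section Finite

variable {n : Type*} [Fintype n] [DecidableEq n]

open Matrix

/-! The proposition splits into three independent facts: an equilibrium state exists, every
equilibrium state is `w₁`-Gibbs, and there is at most one `w₁`-Gibbs state.

Existence is a compactness argument. Extend each local Gibbs state to the whole lattice, average it
over the translations of its box, and pass to a limit `ω` along an ultrafilter on which the
finite-volume pressure tends to its limsup `P`. The boxes are a Følner family, so `ω` is invariant
and boundary terms vanish in the limit; in particular `H_Λ` is, up to `o(|Λ|)`, the sum of the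
translates of `E_Φ`. The entropy must not drop in the limit. This follows from the variational
formula `S(ρ) = inf_K (ρ(K) + log Tr e^{-K})` (`entropy_le`, `le_entropy`): a trial Hamiltonian `K`
on a small box is copied onto disjoint translates tiling a large box, partition functions multiply,
and averaging over all positions of the tiling gives `card_mul_entropy_le`, hence
`mul_card_le_entropy_marginal`. Applied to a constant family, the same lemma shows that the entropy
density converges, without any appeal to subadditivity. Thus `P ≤ s(ω) - ω(E_Φ)`, while
nonnegativity of the relative entropy gives the reverse bound for every invariant state. Convergence
of the pressure is never needed.

For an equilibrium state, `s(ω‖Φ)` is at most `-s(ω) + ω(E_Φ) + P ≤ 0`, so the transportation-cost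
inequality forces `w₁(ω, Φ) = 0`.

Uniqueness is `W₁` duality. The sum over a box of the translates of a local observable `A` on `X` is
Lipschitz: an operator with vanishing partial trace at one site sees at most `|X|` of the
translates. Hence its expectations in `ρ_Λ` and `ω^Φ_Λ` differ by `o(|Λ|)` when `w₁(ρ, Φ) = 0`, and
`ρ(A)` is the limit of averages in the local Gibbs states, which do not involve `ρ`. -/

theorem continuousOn_spectrum (A : Matrix n n ℂ) (f : ℝ → ℝ) : ContinuousOn f (spectrum ℝ A) :=
  A.finite_real_spectrum.continuousOn f

theorem continuousOn_image_spectrum (A : Matrix n n ℂ) (f g : ℝ → ℝ) :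
    ContinuousOn g (f '' spectrum ℝ A) :=
  (A.finite_real_spectrum.image f).continuousOn g

theorem isHermitian_cfc (A : Matrix n n ℂ) (f : ℝ → ℝ) : (cfc f A).IsHermitian :=
  cfc_predicate f A

theorem cfc_id_of_isHermitian {A : Matrix n n ℂ} (hA : A.IsHermitian) :
    cfc (fun x : ℝ => x) A = A := cfc_id' ℝ A hA

theorem cfc_neg_of_isHermitian {A : Matrix n n ℂ} (hA : A.IsHermitian) :
    cfc (fun x : ℝ => -x) A = -A := cfc_neg_id A hA

/-- The spectrum is finite, so every real function is continuous on it. This covers `Real.log`,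
which is discontinuous at `0`. -/
theorem cfc_cfc {A : Matrix n n ℂ} (hA : A.IsHermitian) (f g : ℝ → ℝ) :
    cfc g (cfc f A) = cfc (fun x => g (f x)) A :=
  (cfc_comp' g f A (continuousOn_image_spectrum A f g) (continuousOn_spectrum A f) hA).symm

open Matrix.Norms.L2Operator in
theorem exp_eq_cfc {K : Matrix n n ℂ} (hK : K.IsHermitian) :
    NormedSpace.exp K = cfc Real.exp K :=
  (CFC.real_exp_eq_normedSpace_exp (a := K) hK).symm

theorem exp_neg_eq_cfc {K : Matrix n n ℂ} (hK : K.IsHermitian) :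
    NormedSpace.exp (-K) = cfc (fun x => Real.exp (-x)) K := by
  rw [exp_eq_cfc hK.neg, ← cfc_cfc hK (fun x => -x) Real.exp, cfc_neg_of_isHermitian hK]

theorem trace_cfc {A : Matrix n n ℂ} (hA : A.IsHermitian) (f : ℝ → ℝ) :
    (cfc f A).trace = ((∑ i, f (hA.eigenvalues i) : ℝ) : ℂ) := by
  rw [hA.cfc_eq, Matrix.IsHermitian.cfc, Unitary.conjStarAlgAut_apply, Matrix.trace_mul_cycle]
  simp [Matrix.trace, Function.comp_def]

/-- The trace of a product of functions of two Hermitian matrices, in terms of the doubly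
stochastic matrix of the overlaps of their eigenbases. -/
theorem exists_trace_cfc_mul_cfc {A B : Matrix n n ℂ} (hA : A.IsHermitian) (hB : B.IsHermitian) :
    ∃ w : n → n → ℝ, (∀ i j, 0 ≤ w i j) ∧ (∀ i, ∑ j, w i j = 1) ∧ (∀ j, ∑ i, w i j = 1) ∧
      ∀ f g : ℝ → ℝ, (cfc f A * cfc g B).trace =
        ((∑ i, ∑ j, f (hA.eigenvalues i) * g (hB.eigenvalues j) * w i j : ℝ) : ℂ) := by
  set W : Matrix n n ℂ := star (hA.eigenvectorUnitary : Matrix n n ℂ) * hB.eigenvectorUnitary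
    with hW
  have h1 : W * star W = 1 := by
    rw [hW, star_mul, star_star, mul_assoc, ← mul_assoc (hB.eigenvectorUnitary : Matrix n n ℂ)]
    simp
  have h2 : star W * W = 1 := by
    rw [hW, star_mul, star_star, mul_assoc, ← mul_assoc (hA.eigenvectorUnitary : Matrix n n ℂ)]
    simp
  have hw : ∀ i j, W i j * star (W i j) = ((‖W i j‖ ^ 2 : ℝ) : ℂ) := by
    intro i j
    simpa using RCLike.mul_conj (W i j)
  refine ⟨fun i j => ‖W i j‖ ^ 2, fun i j => by positivity, ?_, ?_, ?_⟩
  · intro i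
    have := congrFun (congrFun h1 i) i
    simp only [Matrix.mul_apply, Matrix.star_apply, hw, Matrix.one_apply_eq] at this
    exact_mod_cast this
  · intro j
    have := congrFun (congrFun h2 j) j
    simp only [Matrix.mul_apply, Matrix.star_apply, mul_comm (star _), hw,
      Matrix.one_apply_eq] at this
    exact_mod_cast this
  · intro f g
    have h3 : (cfc f A * cfc g B).trace = (diagonal (fun i => ((f (hA.eigenvalues i) : ℝ) : ℂ)) *
        (W * (diagonal (fun i => ((g (hB.eigenvalues i) : ℝ) : ℂ)) * star W))).trace := by
      rw [hA.cfc_eq, hB.cfc_eq, Matrix.IsHermitian.cfc, Matrix.IsHermitian.cfc,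
        Unitary.conjStarAlgAut_apply, Unitary.conjStarAlgAut_apply, hW, star_mul, star_star]
      simp only [mul_assoc]
      rw [Matrix.trace_mul_comm]
      simp only [mul_assoc]
      rfl
    rw [h3]
    simp only [Matrix.trace, Matrix.diag, Matrix.diagonal_mul]
    push_cast
    refine Finset.sum_congr rfl fun i _ => ?_
    rw [Matrix.mul_apply, Finset.mul_sum]
    refine Finset.sum_congr rfl fun j _ => ?_
    have := hw i j
    push_cast at this
    rw [Matrix.diagonal_mul, Matrix.star_apply, ← this]
    ring

theorem trace_mul_comm_cfc {A : Matrix n n ℂ} (hA : A.IsHermitian) (f : ℝ → ℝ) :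
    (A * cfc f A).trace = ((∑ i, hA.eigenvalues i * f (hA.eigenvalues i) : ℝ) : ℂ) := by
  have h : A * cfc f A = cfc (fun x => x * f x) A := by
    rw [cfc_mul (fun x => x) f A (continuousOn_spectrum A _) (continuousOn_spectrum A _),
      cfc_id_of_isHermitian hA]
  rw [h, trace_cfc hA]

theorem entropy_eq_sum {ρ : Matrix n n ℂ} (hρ : ρ.IsHermitian) :
    entropy ρ = ∑ i, Real.negMulLog (hρ.eigenvalues i) := by
  rw [entropy, trace_mul_comm_cfc hρ, Complex.ofReal_re, ← Finset.sum_neg_distrib]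
  exact Finset.sum_congr rfl fun i _ => by rw [Real.negMulLog]; ring

theorem sum_eigenvalues_eq_one {ρ : Matrix n n ℂ} (hρ : ρ.IsHermitian) (h1 : ρ.trace = 1) :
    ∑ i, hρ.eigenvalues i = 1 := by
  have := hρ.trace_eq_sum_eigenvalues
  rw [h1] at this
  have := congrArg Complex.re this
  rw [Complex.re_sum] at this
  exact this.symm

theorem entropy_nonneg {ρ : Matrix n n ℂ} (hρ : ρ.PosSemidef) (h1 : ρ.trace = 1) :
    0 ≤ entropy ρ := by
  rw [entropy_eq_sum hρ.1]
  refine Finset.sum_nonneg fun i _ => Real.negMulLog_nonneg (hρ.eigenvalues_nonneg i) ?_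
  rw [← sum_eigenvalues_eq_one hρ.1 h1]
  exact Finset.single_le_sum (f := fun i => hρ.1.eigenvalues i)
    (fun j _ => hρ.eigenvalues_nonneg j) (Finset.mem_univ i)

/-! ### Gibbs states and the variational formula for the entropy -/

/-- The partition function `Tr e^{-K}`. -/
def partition (K : Matrix n n ℂ) : ℝ := (NormedSpace.exp (-K)).trace.re

theorem partition_eq_sum {K : Matrix n n ℂ} (hK : K.IsHermitian) :
    partition K = ∑ i, Real.exp (-hK.eigenvalues i) := by
  rw [partition, exp_neg_eq_cfc hK, trace_cfc hK, Complex.ofReal_re]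

theorem trace_exp_neg {K : Matrix n n ℂ} (hK : K.IsHermitian) :
    (NormedSpace.exp (-K)).trace = partition K := by
  rw [partition, exp_neg_eq_cfc hK, trace_cfc hK, Complex.ofReal_re]

theorem partition_pos [Nonempty n] {K : Matrix n n ℂ} (hK : K.IsHermitian) : 0 < partition K := by
  rw [partition_eq_sum hK]
  exact Finset.sum_pos (fun i _ => Real.exp_pos _) Finset.univ_nonempty

/-- This is `log y ≤ y - 1` at `y = e^{-k} / (Z x)`, multiplied by `x`. Averaged over pairs of
eigenvalues, the first two terms on the right cancel and only `log Z` survives. -/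
theorem negMulLog_sub_mul_le {x k Z : ℝ} (hx : 0 ≤ x) (hZ : 0 < Z) :
    Real.negMulLog x - x * k ≤ Real.exp (-k) / Z - x + x * Real.log Z := by
  rcases hx.eq_or_lt with rfl | hx
  · simp only [Real.negMulLog_zero, zero_mul, sub_zero, add_zero]
    positivity
  · have h := Real.log_le_sub_one_of_pos (x := Real.exp (-k) / (Z * x)) (by positivity)
    rw [Real.log_div (by positivity) (by positivity), Real.log_exp,
      Real.log_mul hZ.ne' hx.ne'] at h
    have h2 := mul_le_mul_of_nonneg_left h hx.le
    have h3 : x * (Real.exp (-k) / (Z * x) - 1) = Real.exp (-k) / Z - x := by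
      field_simp
    rw [h3] at h2
    rw [Real.negMulLog]
    linarith

/-- The Gibbs variational inequality. -/
theorem entropy_le {ρ K : Matrix n n ℂ} [Nonempty n] (hρ : ρ.PosSemidef) (h1 : ρ.trace = 1)
    (hK : K.IsHermitian) : entropy ρ ≤ (ρ * K).trace.re + Real.log (partition K) := by
  obtain ⟨w, hw0, hw1, hw2, hw⟩ := exists_trace_cfc_mul_cfc hρ.1 hK
  have hZ := partition_pos hK
  have e1 : entropy ρ = ∑ i, ∑ j, Real.negMulLog (hρ.1.eigenvalues i) * w i j := by
    rw [entropy_eq_sum hρ.1]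
    simp only [← Finset.mul_sum, hw1, mul_one]
  have e2 : (ρ * K).trace.re
      = ∑ i, ∑ j, hρ.1.eigenvalues i * hK.eigenvalues j * w i j := by
    have := hw (fun x => x) (fun x => x)
    rw [cfc_id_of_isHermitian hρ.1, cfc_id_of_isHermitian hK] at this
    rw [this, Complex.ofReal_re]
  -- The column sums of `w` make the terms `e^{-k}/Z` add up to one, and the row sums do so for the
  -- eigenvalues of `ρ`.
  have e3 : ∑ i, ∑ j, (Real.exp (-hK.eigenvalues j) / partition K - hρ.1.eigenvalues i
      + hρ.1.eigenvalues i * Real.log (partition K)) * w i j = Real.log (partition K) := by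
    have a1 : ∑ i, ∑ j, Real.exp (-hK.eigenvalues j) / partition K * w i j = 1 := by
      rw [Finset.sum_comm]
      simp only [← Finset.mul_sum, hw2, mul_one, ← Finset.sum_div, ← partition_eq_sum hK]
      exact div_self hZ.ne'
    have a2 : ∑ i, ∑ j, hρ.1.eigenvalues i * w i j = 1 := by
      simp only [← Finset.mul_sum, hw1, mul_one]
      exact sum_eigenvalues_eq_one hρ.1 h1
    calc _ = ∑ i, ∑ j, Real.exp (-hK.eigenvalues j) / partition K * w i j
          - ∑ i, ∑ j, hρ.1.eigenvalues i * w i j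
          + Real.log (partition K) * ∑ i, ∑ j, hρ.1.eigenvalues i * w i j := by
          simp only [Finset.mul_sum, ← Finset.sum_sub_distrib, ← Finset.sum_add_distrib]
          exact Finset.sum_congr rfl fun i _ => Finset.sum_congr rfl fun j _ => by ring
      _ = _ := by rw [a1, a2]; ring
  have key : ∑ i, ∑ j, (Real.negMulLog (hρ.1.eigenvalues i) * w i j
      - hρ.1.eigenvalues i * hK.eigenvalues j * w i j) ≤ Real.log (partition K) := by
    rw [← e3]
    refine Finset.sum_le_sum fun i _ => Finset.sum_le_sum fun j _ => ?_
    rw [← sub_mul]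
    exact mul_le_mul_of_nonneg_right
      (negMulLog_sub_mul_le (hρ.eigenvalues_nonneg i) hZ) (hw0 i j)
  simp only [Finset.sum_sub_distrib] at key
  rw [e1, e2]
  linarith

/-- The Gibbs variational inequality is sharp. -/
theorem le_entropy {ρ : Matrix n n ℂ} (hρ : ρ.PosSemidef) (h1 : ρ.trace = 1) {c : ℝ}
    (h : ∀ K : Matrix n n ℂ, K.IsHermitian → c ≤ (ρ * K).trace.re + Real.log (partition K)) :
    c ≤ entropy ρ := by
  have key : ∀ M : ℝ, c ≤ entropy ρ + Fintype.card n * Real.exp (-M) := by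
    intro M
    -- The optimal `K` would be `-log ρ`, infinite on the kernel of `ρ`. A finite level `M` there
    -- leaves `Tr ρK` equal to the entropy and costs at most `n e^{-M}` in the partition function,
    -- which vanishes as `M → ∞`.
    let κ : ℝ → ℝ := fun x => if x = 0 then M else -Real.log x
    have h2 := h (cfc κ ρ) (isHermitian_cfc ρ κ)
    have e1 : (ρ * cfc κ ρ).trace.re = entropy ρ := by
      rw [trace_mul_comm_cfc hρ.1, Complex.ofReal_re, entropy_eq_sum hρ.1]
      refine Finset.sum_congr rfl fun i _ => ?_
      by_cases h0 : hρ.1.eigenvalues i = 0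
      · simp [h0]
      · simp only [κ, if_neg h0, Real.negMulLog]
        ring
    have e2 : partition (cfc κ ρ) ≤ 1 + Fintype.card n * Real.exp (-M) := by
      rw [partition, exp_neg_eq_cfc (isHermitian_cfc ρ κ), cfc_cfc hρ.1, trace_cfc hρ.1,
        Complex.ofReal_re, ← sum_eigenvalues_eq_one hρ.1 h1]
      calc _ ≤ ∑ i, (hρ.1.eigenvalues i + Real.exp (-M)) := by
            refine Finset.sum_le_sum fun i _ => ?_
            by_cases h0 : hρ.1.eigenvalues i = 0
            · simp [κ, h0]
            · simp only [κ, if_neg h0, neg_neg]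
              rw [Real.exp_log ((hρ.eigenvalues_nonneg i).lt_of_ne' h0)]
              linarith [Real.exp_pos (-M)]
        _ = _ := by rw [Finset.sum_add_distrib]; simp
    have : Nonempty n := by
      by_contra hn
      rw [not_nonempty_iff] at hn
      simp [Matrix.trace] at h1
    have hpos := partition_pos (isHermitian_cfc ρ κ)
    have := Real.log_le_sub_one_of_pos hpos
    rw [e1] at h2
    linarith
  have ht : Tendsto (fun M : ℝ => entropy ρ + Fintype.card n * Real.exp (-M)) atTop
      (nhds (entropy ρ + Fintype.card n * 0)) :=
    (Real.tendsto_exp_neg_atTop_nhds_zero.const_mul _).const_add _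
  rw [mul_zero, add_zero] at ht
  exact ge_of_tendsto' ht key

theorem exists_eq_conjTranspose_mul_self {A : Matrix n n ℂ} (hA : A.PosSemidef) :
    ∃ B : Matrix n n ℂ, A = Bᴴ * B := by
  refine ⟨cfc Real.sqrt A, ?_⟩
  rw [(isHermitian_cfc A _).eq, ← cfc_mul Real.sqrt Real.sqrt A (continuousOn_spectrum A _)
    (continuousOn_spectrum A _)]
  have : cfc (fun x : ℝ => Real.sqrt x * Real.sqrt x) A = cfc (fun x : ℝ => x) A := by
    refine cfc_congr fun x hx => Real.mul_self_sqrt ?_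
    obtain ⟨i, rfl⟩ := hA.1.spectrum_real_eq_range_eigenvalues ▸ hx
    exact hA.eigenvalues_nonneg i
  rw [this, cfc_id_of_isHermitian hA.1]

theorem gibbs_eq_cfc {H : Matrix n n ℂ} (hH : H.IsHermitian) :
    gibbs H = cfc (fun x => (partition H)⁻¹ * Real.exp (-x)) H := by
  rw [gibbs, trace_exp_neg hH, exp_neg_eq_cfc hH,
    cfc_const_mul _ _ H (continuousOn_spectrum H _)]
  ext i j
  simp

theorem posSemidef_cfc (A : Matrix n n ℂ) {f : ℝ → ℝ} (hf : ∀ x, 0 ≤ f x) :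
    (cfc f A).PosSemidef := by
  have : cfc f A = (cfc (fun x => Real.sqrt (f x)) A)ᴴ * cfc (fun x => Real.sqrt (f x)) A := by
    rw [(isHermitian_cfc A _).eq, ← cfc_mul _ _ A (continuousOn_spectrum A _)
      (continuousOn_spectrum A _)]
    exact cfc_congr fun x _ => (Real.mul_self_sqrt (hf x)).symm
  rw [this]
  exact Matrix.posSemidef_conjTranspose_mul_self _

theorem posSemidef_gibbs [Nonempty n] {H : Matrix n n ℂ} (hH : H.IsHermitian) :
    (gibbs H).PosSemidef := by
  rw [gibbs_eq_cfc hH]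
  have := partition_pos hH
  exact posSemidef_cfc H fun x => by positivity

theorem trace_gibbs [Nonempty n] {H : Matrix n n ℂ} (hH : H.IsHermitian) :
    (gibbs H).trace = 1 := by
  rw [gibbs, Matrix.trace_smul, smul_eq_mul, inv_mul_cancel₀]
  rw [trace_exp_neg hH]
  exact_mod_cast (partition_pos hH).ne'

theorem log_gibbs [Nonempty n] {H : Matrix n n ℂ} (hH : H.IsHermitian) :
    cfc Real.log (gibbs H) = -H - (Real.log (partition H) : ℂ) • 1 := by
  have hZ := partition_pos hH
  rw [gibbs_eq_cfc hH, cfc_cfc hH]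
  have : ∀ x, Real.log ((partition H)⁻¹ * Real.exp (-x)) = -x - Real.log (partition H) := by
    intro x
    rw [Real.log_mul (by positivity) (by positivity), Real.log_inv, Real.log_exp]
    ring
  simp only [this]
  have hc : cfc (fun _ : ℝ => Real.log (partition H)) H
      = algebraMap ℝ _ (Real.log (partition H)) := cfc_const _ H hH
  rw [cfc_sub (fun x => -x) _ H (continuousOn_spectrum H _) (continuousOn_spectrum H _),
    cfc_neg_of_isHermitian hH, hc, Algebra.algebraMap_eq_smul_one]
  congr 1
-- Identifies the relative entropy with the gap in the Gibbs variational inequality.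
theorem relEntropy_gibbs [Nonempty n] {ρ H : Matrix n n ℂ} (h1 : ρ.trace = 1)
    (hH : H.IsHermitian) :
    relEntropy ρ (gibbs H) = -entropy ρ + (ρ * H).trace.re + Real.log (partition H) := by
  rw [relEntropy, log_gibbs hH, entropy, mul_sub, mul_sub, mul_neg, Matrix.mul_smul, mul_one,
    Matrix.trace_sub, Matrix.trace_sub, Matrix.trace_neg, Matrix.trace_smul, h1]
  simp
  ring

theorem entropy_gibbs [Nonempty n] {H : Matrix n n ℂ} (hH : H.IsHermitian) :
    entropy (gibbs H) = (gibbs H * H).trace.re + Real.log (partition H) := by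
  have h := relEntropy_gibbs (trace_gibbs hH) hH
  rw [relEntropy, sub_self, mul_zero, Matrix.trace_zero, Complex.zero_re] at h
  linarith

theorem relEntropy_gibbs_nonneg [Nonempty n] {ρ H : Matrix n n ℂ} (hρ : ρ.PosSemidef)
    (h1 : ρ.trace = 1) (hH : H.IsHermitian) : 0 ≤ relEntropy ρ (gibbs H) := by
  have := entropy_le hρ h1 hH
  rw [relEntropy_gibbs h1 hH]
  linarith

/-! ### The trace norm -/

theorem traceNorm_eq_sum {E : Matrix n n ℂ} (hE : E.IsHermitian) :
    traceNorm E = ∑ i, |hE.eigenvalues i| := by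
  have h : Eᴴ * E = cfc (fun x : ℝ => x * x) E := by
    rw [hE.eq, cfc_mul (fun x => x) (fun x => x) E (continuousOn_spectrum E _)
      (continuousOn_spectrum E _), cfc_id_of_isHermitian hE]
  rw [traceNorm, h, cfc_cfc hE, trace_cfc hE, Complex.ofReal_re]
  exact Finset.sum_congr rfl fun i _ => Real.sqrt_mul_self_eq_abs _

theorem traceNorm_nonneg {E : Matrix n n ℂ} (hE : E.IsHermitian) : 0 ≤ traceNorm E := by
  rw [traceNorm_eq_sum hE]
  exact Finset.sum_nonneg fun i _ => abs_nonneg _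

open Matrix.Norms.L2Operator in
theorem norm_entry_le (A : Matrix n n ℂ) (i j : n) :
    ‖A i j‖ ≤ ‖Matrix.toEuclideanCLM (𝕜 := ℂ) A‖ := by
  have h := A.l2_opNorm_mulVec (EuclideanSpace.single j (1 : ℂ))
  have h2 : ‖EuclideanSpace.single j (1 : ℂ)‖ = 1 := by simp
  rw [h2, mul_one] at h
  refine le_trans ?_ h
  refine le_trans (le_of_eq ?_) (PiLp.norm_apply_le _ i)
  simp

theorem norm_unitary_conj_entry_le (U : unitary (Matrix n n ℂ)) (B : Matrix n n ℂ) (i j : n) :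
    ‖(star (U : Matrix n n ℂ) * B * U) i j‖ ≤ ‖Matrix.toEuclideanCLM (𝕜 := ℂ) B‖ := by
  refine (norm_entry_le _ i j).trans (le_of_eq ?_)
  let T := Matrix.toEuclideanCLM (n := n) (𝕜 := ℂ)
  have hV : T U ∈ unitary (EuclideanSpace ℂ n →L[ℂ] EuclideanSpace ℂ n) := by
    rw [Unitary.mem_iff, ← map_star, ← map_mul, ← map_mul]
    simp
  have hV' : star (T U) ∈ unitary (EuclideanSpace ℂ n →L[ℂ] EuclideanSpace ℂ n) :=
    Unitary.star_mem hV
  change ‖T _‖ = ‖T B‖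
  rw [map_mul, map_mul, map_star, CStarRing.norm_mul_mem_unitary _ hV,
    CStarRing.norm_mem_unitary_mul _ hV']

/-- In an eigenbasis of `E` the trace is the sum of the eigenvalues weighted by diagonal entries of
`B`, each bounded by the operator norm. -/
theorem norm_trace_mul_le {E : Matrix n n ℂ} (hE : E.IsHermitian) (B : Matrix n n ℂ) :
    ‖(E * B).trace‖ ≤ traceNorm E * ‖Matrix.toEuclideanCLM (𝕜 := ℂ) B‖ := by
  have h : (E * B).trace = ∑ i, (hE.eigenvalues i : ℂ) *
      (star (hE.eigenvectorUnitary : Matrix n n ℂ) * B * hE.eigenvectorUnitary) i i := by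
    have h0 : (E * B).trace = ((hE.eigenvectorUnitary : Matrix n n ℂ) *
        diagonal (RCLike.ofReal ∘ hE.eigenvalues)
        * star (hE.eigenvectorUnitary : Matrix n n ℂ) * B).trace := by
      conv_lhs => rw [hE.spectral_theorem, Unitary.conjStarAlgAut_apply]
    rw [h0, mul_assoc, mul_assoc, Matrix.trace_mul_comm, mul_assoc]
    simp only [Matrix.trace, Matrix.diag, Matrix.diagonal_mul, Function.comp_apply]
    rfl
  rw [h, traceNorm_eq_sum hE, Finset.sum_mul]
  refine (norm_sum_le _ _).trans (Finset.sum_le_sum fun i _ => ?_)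
  rw [norm_mul]
  exact mul_le_mul (by simp) (norm_unitary_conj_entry_le _ B i i) (norm_nonneg _) (abs_nonneg _)

/-- In an eigenbasis of `R - T` each eigenvalue is a difference of nonnegative diagonal entries of
`R` and `T`, so its modulus is at most their sum. -/
theorem traceNorm_sub_le {R T : Matrix n n ℂ} (hR : R.PosSemidef) (hT : T.PosSemidef) :
    traceNorm (R - T) ≤ R.trace.re + T.trace.re := by
  have hE : (R - T).IsHermitian := hR.1.sub hT.1
  let U : Matrix n n ℂ := hE.eigenvectorUnitary
  have hU : U * Uᴴ = 1 := Unitary.mul_star_self_of_mem hE.eigenvectorUnitary.2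
  have hR' := hR.conjTranspose_mul_mul_same U
  have hT' := hT.conjTranspose_mul_mul_same U
  have tr : ∀ M : Matrix n n ℂ, M.trace.re = ∑ i, ((Uᴴ * M * U) i i).re := by
    intro M
    have : (Uᴴ * M * U).trace = M.trace := by
      rw [Matrix.trace_mul_cycle, hU, one_mul]
    rw [← this, Matrix.trace, Complex.re_sum]
    rfl
  have hd : ∀ i, hE.eigenvalues i = ((Uᴴ * R * U) i i).re - ((Uᴴ * T * U) i i).re := by
    intro i
    have h1 : Uᴴ * (R - T) * U = diagonal (RCLike.ofReal ∘ hE.eigenvalues) := by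
      have := hE.conjStarAlgAut_star_eigenvectorUnitary
      rw [Unitary.conjStarAlgAut_apply] at this
      rw [Unitary.coe_star, star_star] at this
      exact this
    have h2 := congrFun (congrFun h1 i) i
    rw [mul_sub, sub_mul] at h2
    have h3 := congrArg Complex.re h2
    simp only [Matrix.sub_apply, Complex.sub_re, Matrix.diagonal_apply_eq,
      Function.comp_apply] at h3
    rw [h3]
    rfl
  rw [traceNorm_eq_sum hE, tr R, tr T, ← Finset.sum_add_distrib]
  refine Finset.sum_le_sum fun i _ => ?_
  have h1 : 0 ≤ ((Uᴴ * R * U) i i).re := (Complex.le_def.1 (hR'.diag_nonneg (i := i))).1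
  have h2 : 0 ≤ ((Uᴴ * T * U) i i).re := (Complex.le_def.1 (hT'.diag_nonneg (i := i))).1
  rw [hd, abs_le]
  constructor <;> linarith

end Finite

variable {d q : ℕ}

/-! ### Local observables -/

/-- The inclusion of the local observables into the quasi-local algebra as a homomorphism. -/
def toQLHom (Λ : Finset (Site d)) : LocalObs d q Λ →⋆ₐ[ℂ] quasiLocal d q :=
  StarAlgHom.codRestrict (localEmb Λ) (quasiLocal d q) (localEmb_mem Λ)

theorem toQLHom_apply {Λ : Finset (Site d)} (A : LocalObs d q Λ) : toQLHom Λ A = toQL A := rfl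

theorem toQL_incl {X Λ : Finset (Site d)} (h : X ⊆ Λ) (A : LocalObs d q X) :
    toQL (incl h A) = toQL A :=
  Subtype.ext (localEmb_incl h A)

theorem norm_toQL [NeZero q] {Λ : Finset (Site d)} (A : LocalObs d q Λ) : ‖toQL A‖ = opNorm A :=
  norm_localEmb A

/-- Algebraic identities for `incl` are checked after applying `toQL`, where the inclusion
disappears by `toQL_incl`. -/
theorem toQL_injective [NeZero q] (Λ : Finset (Site d)) :
    Function.Injective (toQL : LocalObs d q Λ → quasiLocal d q) := fun _ _ h =>
  localEmb_injective Λ (congrArg Subtype.val h)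

/-- The inclusion of observables as a homomorphism. -/
def inclHom [NeZero q] {X Λ : Finset (Site d)} (h : X ⊆ Λ) :
    LocalObs d q X →⋆ₐ[ℂ] LocalObs d q Λ where
  toFun := incl h
  map_one' := toQL_injective Λ (by
    rw [toQL_incl, ← toQLHom_apply, ← toQLHom_apply, map_one, map_one])
  map_mul' A B := toQL_injective Λ (by
    rw [toQL_incl, ← toQLHom_apply, ← toQLHom_apply, map_mul, map_mul, toQLHom_apply (incl h A),
      toQLHom_apply (incl h B), toQL_incl, toQL_incl]
    rfl)
  map_zero' := toQL_injective Λ (by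
    rw [toQL_incl, ← toQLHom_apply, ← toQLHom_apply, map_zero, map_zero])
  map_add' A B := toQL_injective Λ (by
    rw [toQL_incl, ← toQLHom_apply, ← toQLHom_apply, map_add, map_add, toQLHom_apply (incl h A),
      toQLHom_apply (incl h B), toQL_incl, toQL_incl]
    rfl)
  commutes' c := toQL_injective Λ (by
    rw [toQL_incl, ← toQLHom_apply, ← toQLHom_apply, AlgHomClass.commutes, AlgHomClass.commutes])
  map_star' A := toQL_injective Λ (by
    rw [toQL_incl, ← toQLHom_apply, ← toQLHom_apply, map_star, map_star, toQLHom_apply (incl h A),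
      toQL_incl]
    rfl)

theorem inclHom_apply [NeZero q] {X Λ : Finset (Site d)} (h : X ⊆ Λ) (A : LocalObs d q X) :
    inclHom h A = incl h A := rfl

theorem isHermitian_incl [NeZero q] {X Λ : Finset (Site d)} (h : X ⊆ Λ) {A : LocalObs d q X}
    (hA : A.IsHermitian) : (incl h A).IsHermitian := by
  have : star (inclHom h A) = inclHom h A := by
    rw [← map_star]
    exact congrArg _ hA
  exact this

theorem opNorm_incl [NeZero q] {X Λ : Finset (Site d)} (h : X ⊆ Λ) (A : LocalObs d q X) :
    opNorm (incl h A) = opNorm A := by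
  rw [← norm_toQL, toQL_incl, norm_toQL]

section DisjointUnion

variable {Y Z Λ : Finset (Site d)}

theorem incl_mul_incl_apply (hY : Y ⊆ Λ) (hZ : Z ⊆ Λ) (hd : Disjoint Y Z) (hu : Λ ⊆ Y ∪ Z)
    (A : LocalObs d q Y) (B : LocalObs d q Z) (s t : Λ → Fin q) :
    (incl hY A * incl hZ B) s t =
      A (fun y => s ⟨y.1, hY y.2⟩) (fun y => t ⟨y.1, hY y.2⟩) *
      B (fun y => s ⟨y.1, hZ y.2⟩) (fun y => t ⟨y.1, hZ y.2⟩) := by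
  -- The first factor forces the intermediate configuration to equal `s` off `Y`, the second forces
  -- it to equal `t` off `Z`, in particular on `Y`. Only one configuration remains.
  rw [Matrix.mul_apply, Finset.sum_eq_single (fun p => if p.1 ∈ Y then t p else s p)]
  · rw [incl, incl, Matrix.of_apply, Matrix.of_apply, if_pos, if_pos]
    · congr 2
      · funext y
        simp
      · funext y
        simp [Finset.disjoint_right.1 hd y.2]
    · intro y hy
      have : y.1 ∈ Y := by
        have := hu y.2
        simp only [Finset.mem_union] at this
        tauto
      simp [this]
    · intro y hy
      simp [hy]
  · intro u _ hne
    by_contra h0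
    apply hne
    have h1 : ∀ y : Λ, y.1 ∉ Y → s y = u y := by
      by_contra h
      refine h0 ?_
      rw [show incl hY A s u = 0 from if_neg h, zero_mul]
    have h2 : ∀ y : Λ, y.1 ∉ Z → u y = t y := by
      by_contra h
      refine h0 ?_
      rw [show incl hZ B u t = 0 from if_neg h, mul_zero]
    funext p
    by_cases hp : p.1 ∈ Y
    · simp [hp, h2 p (Finset.disjoint_left.1 hd hp)]
    · simp [hp, h1 p hp]
  · simp

/-- Restricting the configurations of a disjoint union to the two parts. -/
def configUnionEquiv (hY : Y ⊆ Λ) (hZ : Z ⊆ Λ) (hd : Disjoint Y Z) (hu : Λ ⊆ Y ∪ Z) :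
    (Λ → Fin q) ≃ (Y → Fin q) × (Z → Fin q) where
  toFun s := (fun y => s ⟨y.1, hY y.2⟩, fun y => s ⟨y.1, hZ y.2⟩)
  invFun u := fun p => if h : p.1 ∈ Y then u.1 ⟨p.1, h⟩ else
    u.2 ⟨p.1, (Finset.mem_union.1 (hu p.2)).resolve_left h⟩
  left_inv s := by
    funext p
    by_cases h : p.1 ∈ Y <;> simp [h]
  right_inv u := by
    refine Prod.ext ?_ ?_
    · funext y
      simp
    · funext y
      simp [Finset.disjoint_right.1 hd y.2]

theorem trace_incl_mul_incl (hY : Y ⊆ Λ) (hZ : Z ⊆ Λ) (hd : Disjoint Y Z) (hu : Λ ⊆ Y ∪ Z)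
    (A : LocalObs d q Y) (B : LocalObs d q Z) :
    (incl hY A * incl hZ B).trace = A.trace * B.trace := by
  simp only [Matrix.trace, Matrix.diag, incl_mul_incl_apply hY hZ hd hu]
  rw [Finset.sum_mul_sum, ← Finset.sum_product', Finset.univ_product_univ]
  exact Fintype.sum_equiv (configUnionEquiv hY hZ hd hu) _ _ fun s => rfl

theorem commute_incl_incl (hY : Y ⊆ Λ) (hZ : Z ⊆ Λ) (hd : Disjoint Y Z) (hu : Λ ⊆ Y ∪ Z)
    (A : LocalObs d q Y) (B : LocalObs d q Z) : Commute (incl hY A) (incl hZ B) := by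
  ext s t
  rw [incl_mul_incl_apply hY hZ hd hu,
    incl_mul_incl_apply hZ hY hd.symm (by rwa [Finset.union_comm]), mul_comm]

end DisjointUnion

section MapExp

variable {m n : Type*} [Fintype n] [DecidableEq n] [Fintype m] [DecidableEq m]

open Matrix.Norms.L2Operator in
theorem map_exp_starAlgHom (f : Matrix m m ℂ →⋆ₐ[ℂ] Matrix n n ℂ) (A : Matrix m m ℂ) :
    f (NormedSpace.exp A) = NormedSpace.exp (f A) := by
  let _ : NormedAlgebra ℚ (Matrix m m ℂ) := NormedAlgebra.restrictScalars ℚ ℂ _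
  refine NormedSpace.map_exp f ?_ A
  exact LinearMap.continuous_of_finiteDimensional (f : Matrix m m ℂ →ₗ[ℂ] Matrix n n ℂ)

end MapExp

/-- The summands commute, so the exponential is a tensor product and its trace factorizes.
Hermiticity makes both traces real, so taking real parts respects the product. -/
theorem partition_incl_add_incl [NeZero q] {Y Z Λ : Finset (Site d)} (hY : Y ⊆ Λ) (hZ : Z ⊆ Λ)
    (hd : Disjoint Y Z) (hu : Λ ⊆ Y ∪ Z) {A : LocalObs d q Y} {B : LocalObs d q Z}
    (hA : A.IsHermitian) (hB : B.IsHermitian) :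
    partition (incl hY A + incl hZ B) = partition A * partition B := by
  have h : NormedSpace.exp (-(incl hY A + incl hZ B))
      = incl hY (NormedSpace.exp (-A)) * incl hZ (NormedSpace.exp (-B)) := by
    rw [neg_add, Matrix.exp_add_of_commute, ← inclHom_apply, ← inclHom_apply, ← map_neg, ← map_neg,
      ← map_exp_starAlgHom, ← map_exp_starAlgHom]
    · rfl
    · exact (commute_incl_incl hY hZ hd hu A B).neg_left.neg_right
  rw [partition, h, trace_incl_mul_incl hY hZ hd hu, trace_exp_neg hA, trace_exp_neg hB]
  simp

theorem partition_zero (Λ : Finset (Site d)) :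
    partition (0 : LocalObs d q Λ) = (q : ℝ) ^ Λ.card := by
  rw [partition, neg_zero, NormedSpace.exp_zero, Matrix.trace_one]
  have : ((Fintype.card (Λ → Fin q) : ℂ)).re = Fintype.card (Λ → Fin q) := Complex.natCast_re _
  rw [this]
  simp

/-! ### Translations -/

theorem shiftConj_mul (x : Site d) (S T : Hil d q →L[ℂ] Hil d q) :
    shiftConj x (S * T) = shiftConj x S * shiftConj x T := by
  have h : (permOp (shiftConfig x).symm * permOp (shiftConfig x) : Hil d q →L[ℂ] Hil d q) = 1 := by
    ext ψ s
    change ψ (shiftConfig x ((shiftConfig x).symm s)) = ψ s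
    rw [Equiv.apply_symm_apply]
  simp only [shiftConj, mul_assoc]
  rw [← mul_assoc (permOp (shiftConfig x).symm) (permOp (shiftConfig x)), h, one_mul]

/-- The translation automorphisms as star homomorphisms. -/
def translateHom (x : Site d) : quasiLocal d q →⋆ₐ[ℂ] quasiLocal d q where
  toFun := translate x
  map_one' := Subtype.ext (by
    ext ψ s
    change ψ ((shiftConfig x).symm (shiftConfig x s)) = ψ s
    rw [Equiv.symm_apply_apply])
  map_mul' A B := Subtype.ext (shiftConj_mul x _ _)
  map_zero' := Subtype.ext (by simp [translate, shiftConj])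
  map_add' A B := Subtype.ext (by simp [translate, shiftConj, mul_add, add_mul])
  commutes' c := Subtype.ext (by
    ext ψ s
    change c • ψ ((shiftConfig x).symm (shiftConfig x s)) = c • ψ s
    rw [Equiv.symm_apply_apply])
  map_star' A := Subtype.ext (by
    change shiftConj x (star (A : Hil d q →L[ℂ] Hil d q)) = star (shiftConj x A)
    simp only [shiftConj, star_mul, permOp_adjoint, Equiv.symm_symm, mul_assoc])

theorem translateHom_apply (x : Site d) (A : quasiLocal d q) : translateHom x A = translate x A :=
  rfl

theorem translate_toQL (x : Site d) {Λ : Finset (Site d)} (A : LocalObs d q Λ) :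
    translate x (toQL A) = toQL (shiftObs x A) :=
  Subtype.ext (shiftConj_localEmb x A)

theorem translate_translate (x y : Site d) (A : quasiLocal d q) :
    translate x (translate y A) = translate (x + y) A := by
  have h1 : ∀ s : Config d q, shiftConfig y (shiftConfig x s) = shiftConfig (x + y) s := by
    intro s
    funext z
    simp only [shiftConfig_apply]
    congr 1
    abel
  have h2 : ∀ s : Config d q, (shiftConfig x).symm ((shiftConfig y).symm s)
      = (shiftConfig (x + y)).symm s := by
    intro s
    rw [Equiv.symm_apply_eq, Equiv.symm_apply_eq, h1, Equiv.apply_symm_apply]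
  refine Subtype.ext ?_
  ext ψ s
  change (A : Hil d q →L[ℂ] Hil d q) (permOp (shiftConfig y).symm (permOp (shiftConfig x).symm ψ))
    (shiftConfig y (shiftConfig x s)) = (A : Hil d q →L[ℂ] Hil d q)
      (permOp (shiftConfig (x + y)).symm ψ) (shiftConfig (x + y) s)
  rw [h1]
  have h3 : permOp (shiftConfig y).symm (permOp (shiftConfig x).symm ψ)
      = permOp (shiftConfig (x + y)).symm ψ := by
    ext s
    exact congrArg ψ (h2 s)
  rw [h3]

theorem norm_permOp_le (e : Config d q ≃ Config d q) :
    ‖(permOp e : Hil d q →L[ℂ] Hil d q)‖ ≤ 1 :=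
  ContinuousLinearMap.opNorm_le_bound _ zero_le_one fun ψ => by
    rw [one_mul]
    exact ((permIso e).norm_map ψ).le

theorem norm_translate_le (x : Site d) (A : quasiLocal d q) : ‖translate x A‖ ≤ ‖A‖ := by
  change ‖permOp (shiftConfig x) * (A : Hil d q →L[ℂ] Hil d q) * permOp (shiftConfig x).symm‖ ≤ ‖A‖
  calc _ ≤ ‖permOp (shiftConfig x) * (A : Hil d q →L[ℂ] Hil d q)‖
        * ‖(permOp (shiftConfig x).symm : Hil d q →L[ℂ] Hil d q)‖ := norm_mul_le _ _
    _ ≤ ‖permOp (shiftConfig x) * (A : Hil d q →L[ℂ] Hil d q)‖ * 1 :=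
        mul_le_mul_of_nonneg_left (norm_permOp_le _) (norm_nonneg _)
    _ ≤ ‖(permOp (shiftConfig x) : Hil d q →L[ℂ] Hil d q)‖ * ‖(A : Hil d q →L[ℂ] Hil d q)‖ := by
        rw [mul_one]
        exact norm_mul_le _ _
    _ ≤ 1 * ‖(A : Hil d q →L[ℂ] Hil d q)‖ :=
        mul_le_mul_of_nonneg_right (norm_permOp_le _) (norm_nonneg _)
    _ = ‖A‖ := one_mul _

/-- The bijection of the configurations of `Λ + x` and those of `Λ`. -/
def shiftRegionEquiv (q : ℕ) (x : Site d) (Λ : Finset (Site d)) :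
    (shiftRegion x Λ → Fin q) ≃ (Λ → Fin q) :=
  (Λ.equivMap (Equiv.addRight x).toEmbedding).symm.arrowCongr (Equiv.refl _)

theorem shiftObs_eq_submatrix (x : Site d) {Λ : Finset (Site d)} (A : LocalObs d q Λ) :
    shiftObs x A = A.submatrix (shiftRegionEquiv q x Λ) (shiftRegionEquiv q x Λ) := rfl

theorem isHermitian_shiftObs (x : Site d) {Λ : Finset (Site d)} {A : LocalObs d q Λ}
    (hA : A.IsHermitian) : (shiftObs x A).IsHermitian :=
  hA.submatrix _

theorem opNorm_shiftObs_le [NeZero q] (x : Site d) {Λ : Finset (Site d)} (A : LocalObs d q Λ) :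
    opNorm (shiftObs x A) ≤ opNorm A := by
  rw [← norm_toQL, ← norm_toQL, ← translate_toQL]
  exact norm_translate_le x _

theorem partition_shiftObs (x : Site d) {Λ : Finset (Site d)} (A : LocalObs d q Λ) :
    partition (shiftObs x A) = partition A := by
  let e := shiftRegionEquiv q x Λ
  let f : LocalObs d q Λ →⋆ₐ[ℂ] LocalObs d q (shiftRegion x Λ) :=
    { (Matrix.reindexAlgEquiv ℂ ℂ e.symm : LocalObs d q Λ →ₐ[ℂ] LocalObs d q (shiftRegion x Λ)) with
      map_star' := fun A => rfl }
  have hf : ∀ B, f B = B.submatrix e e := fun B => rfl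
  rw [partition, partition, shiftObs_eq_submatrix, ← hf, ← map_neg, ← map_exp_starAlgHom, hf]
  congr 1
  exact Fintype.sum_equiv e _ _ fun s => rfl

/-! ### States -/

theorem isClosed_quasiLocal :
    IsClosed (quasiLocal d q : Set (Hil d q →L[ℂ] Hil d q)) :=
  StarSubalgebra.isClosed_topologicalClosure _

/-- Positivity of a state is given only on elements `b* b`; writing `‖a‖ ± a` in this form turns it
into norm bounds and reality on self-adjoint elements. -/
theorem exists_star_mul_self_of_isSelfAdjoint {A : Type*} [CStarAlgebra A] {a : A}
    (ha : IsSelfAdjoint a) :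
    (∃ b : A, star b * b = ((‖a‖ : ℝ) : ℂ) • 1 - a) ∧
      ∃ b : A, star b * b = ((‖a‖ : ℝ) : ℂ) • 1 + a := by
  let _ := CStarAlgebra.spectralOrder A
  have _ := CStarAlgebra.spectralOrderedRing A
  have h1 := ha.le_algebraMap_norm_self
  have h2 := ha.neg_algebraMap_norm_le_self
  have h3 : algebraMap ℝ A ‖a‖ = ((‖a‖ : ℝ) : ℂ) • 1 := by
    rw [Algebra.algebraMap_eq_smul_one]
    exact (Complex.coe_smul _ _).symm
  rw [h3] at h1 h2
  obtain ⟨b, hb⟩ := CStarAlgebra.nonneg_iff_eq_star_mul_self.1 (sub_nonneg.2 h1)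
  obtain ⟨b', hb'⟩ := CStarAlgebra.nonneg_iff_eq_star_mul_self.1 (neg_le_iff_add_nonneg.1 h2)
  exact ⟨⟨b, hb.symm⟩, ⟨b', by rw [← hb', add_comm]⟩⟩

theorem exists_star_mul_self_quasiLocal {A : quasiLocal d q} (hA : IsSelfAdjoint A) :
    (∃ b : quasiLocal d q, star b * b = ((‖A‖ : ℝ) : ℂ) • 1 - A) ∧
      ∃ b : quasiLocal d q, star b * b = ((‖A‖ : ℝ) : ℂ) • 1 + A :=
  @exists_star_mul_self_of_isSelfAdjoint _
    (@StarSubalgebra.cstarAlgebra _ _ _ _ _ _ _ (quasiLocal d q) isClosed_quasiLocal) A hA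

theorem State.norm_apply_le_of_isSelfAdjoint (ρ : State d q) {A : quasiLocal d q}
    (hA : IsSelfAdjoint A) : ‖ρ.toLin A‖ ≤ ‖A‖ := by
  obtain ⟨⟨b, hb⟩, ⟨b', hb'⟩⟩ := exists_star_mul_self_quasiLocal hA
  have h1 := ρ.nonneg b
  have h2 := ρ.nonneg b'
  rw [hb, map_sub, map_smul, ρ.map_one, smul_eq_mul, mul_one, Complex.le_def] at h1
  rw [hb', map_add, map_smul, ρ.map_one, smul_eq_mul, mul_one, Complex.le_def] at h2
  simp only [Complex.zero_re, Complex.sub_re, Complex.add_re, Complex.ofReal_re, Complex.zero_im,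
    Complex.sub_im, Complex.ofReal_im] at h1 h2
  have him : (ρ.toLin A).im = 0 := by linarith [h1.2]
  have hre : ρ.toLin A = ((ρ.toLin A).re : ℂ) := Complex.ext rfl (by simpa using him)
  rw [hre, Complex.norm_real, Real.norm_eq_abs, abs_le]
  constructor <;> linarith [h1.1, h2.1]

/-- The factor 2 comes from splitting into real and imaginary parts. The sharp bound is not needed:
only continuity and a bound uniform in the state matter. -/
theorem State.norm_apply_le (ρ : State d q) (A : quasiLocal d q) : ‖ρ.toLin A‖ ≤ 2 * ‖A‖ := by
  have h := realPart_add_I_smul_imaginaryPart A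
  have h1 := ρ.norm_apply_le_of_isSelfAdjoint (realPart A).2
  have h2 := ρ.norm_apply_le_of_isSelfAdjoint (imaginaryPart A).2
  have h3 : ‖(realPart A : quasiLocal d q)‖ ≤ ‖A‖ := realPart.norm_le A
  have h4 : ‖(imaginaryPart A : quasiLocal d q)‖ ≤ ‖A‖ := imaginaryPart.norm_le A
  calc ‖ρ.toLin A‖ = ‖ρ.toLin (realPart A) + Complex.I * ρ.toLin (imaginaryPart A)‖ := by
        conv_lhs => rw [← h, map_add, map_smul, smul_eq_mul]
    _ ≤ ‖ρ.toLin (realPart A)‖ + ‖Complex.I * ρ.toLin (imaginaryPart A)‖ := norm_add_le _ _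
    _ ≤ 2 * ‖A‖ := by
        rw [norm_mul, Complex.norm_I, one_mul]
        linarith

/-- A state as a continuous linear functional. -/
def State.toCLM (ρ : State d q) : quasiLocal d q →L[ℂ] ℂ :=
  ρ.toLin.mkContinuous 2 ρ.norm_apply_le

theorem State.toCLM_apply (ρ : State d q) (A : quasiLocal d q) : ρ.toCLM A = ρ.toLin A := rfl

/-- States are continuous and the strictly local elements are dense. -/
theorem State.ext_of_toQL {ρ σ : State d q}
    (h : ∀ (Λ : Finset (Site d)) (A : LocalObs d q Λ), ρ.toLin (toQL A) = σ.toLin (toQL A)) :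
    ρ = σ := by
  have hlin : ρ.toLin = σ.toLin := by
    ext ⟨T, hT⟩
    have hcl : T ∈ closure (strictlyLocal d q : Set (Hil d q →L[ℂ] Hil d q)) := hT
    obtain ⟨u, hu, hlim⟩ := mem_closure_iff_seq_limit.1 hcl
    have hu' : ∀ k, u k ∈ quasiLocal d q := fun k => StarSubalgebra.le_topologicalClosure _ (hu k)
    have hlim' : Tendsto (fun k => (⟨u k, hu' k⟩ : quasiLocal d q)) atTop (nhds ⟨T, hT⟩) :=
      tendsto_subtype_rng.2 hlim
    have h1 := (ρ.toCLM.continuous.tendsto _).comp hlim'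
    have h2 := (σ.toCLM.continuous.tendsto _).comp hlim'
    refine tendsto_nhds_unique h1 (h2.congr fun k => ?_)
    obtain ⟨Λ, A, hA⟩ := mem_strictlyLocal.1 (hu k)
    have : (⟨u k, hu' k⟩ : quasiLocal d q) = toQL A := Subtype.ext hA.symm
    simp only [Function.comp_apply, this, State.toCLM_apply, h]
  cases ρ
  cases σ
  cases hlin
  rfl

instance nonempty_localConfig [NeZero q] (Λ : Finset (Site d)) : Nonempty (Λ → Fin q) :=
  ⟨fun _ => 0⟩

theorem State.trace_marginal (ρ : State d q) (Λ : Finset (Site d)) :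
    (ρ.marginal Λ).trace = 1 := by
  have := ρ.trace_marginal_mul Λ 1
  rwa [mul_one, ← toQLHom_apply, _root_.map_one, ρ.map_one] at this

theorem State.posSemidef_marginal [NeZero q] (ρ : State d q) (Λ : Finset (Site d)) :
    (ρ.marginal Λ).PosSemidef := by
  have key : ∀ v : (Λ → Fin q) → ℂ, 0 ≤ star v ⬝ᵥ (ρ.marginal Λ).mulVec v := by
    intro v
    let i₀ : Λ → Fin q := fun _ => 0
    -- A rank-one operator with `A* A = |v⟩⟨v|`, so positivity of the state on `A* A` is positivity
    -- of the quadratic form at `v`.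
    let A : LocalObs d q Λ := Matrix.vecMulVec (Pi.single i₀ 1) (star v)
    have h := ρ.nonneg (toQL A)
    have hA : star A * A = Matrix.vecMulVec v (star v) := by
      ext s t
      simp [A, Matrix.mul_apply, Matrix.vecMulVec_apply, Matrix.star_apply, Pi.single_apply,
        mul_ite, ite_mul]
    have h2 : star (toQL A) * toQL A = toQL (Matrix.vecMulVec v (star v)) := by
      rw [← hA, ← toQLHom_apply, ← toQLHom_apply, map_mul, map_star]
    rw [h2, ← ρ.trace_marginal_mul, Matrix.mul_vecMulVec, Matrix.trace_vecMulVec,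
      dotProduct_comm] at h
    exact h
  refine Matrix.posSemidef_iff_dotProduct_mulVec.2 ⟨?_, key⟩
  ext s t
  -- Positivity in the complex order includes reality. Since `‖B‖ - B` is of the form `b* b`, the
  -- state is real on self-adjoint `B`, and real and imaginary parts extend this to compatibility
  -- with `star`.
  have h : ∀ A : LocalObs d q Λ, ρ.toLin (toQL (star A)) = star (ρ.toLin (toQL A)) := by
    intro A
    have hsa : ∀ B : LocalObs d q Λ, IsSelfAdjoint B → star (ρ.toLin (toQL B)) =
        ρ.toLin (toQL B) := by
      intro B hB
      have hB' : IsSelfAdjoint (toQL B) := by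
        rw [← toQLHom_apply]
        exact hB.map (toQLHom Λ)
      obtain ⟨⟨b, hb⟩, -⟩ := exists_star_mul_self_quasiLocal hB'
      have h1 := ρ.nonneg b
      rw [hb, map_sub, map_smul, ρ.map_one, smul_eq_mul, mul_one, Complex.le_def] at h1
      refine Complex.ext rfl ?_
      have h2 := h1.2
      simp only [Complex.zero_im, Complex.sub_im, Complex.ofReal_im] at h2
      change -(ρ.toLin (toQL B)).im = _
      linarith
    have hd := realPart_add_I_smul_imaginaryPart A
    have e1 : ρ.toLin (toQL A) = ρ.toLin (toQL (realPart A : LocalObs d q Λ))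
        + Complex.I * ρ.toLin (toQL (imaginaryPart A : LocalObs d q Λ)) := by
      conv_lhs => rw [← hd, ← toQLHom_apply, map_add, map_smul, map_add, map_smul, smul_eq_mul]
      rfl
    have e2 : ρ.toLin (toQL (star A)) = ρ.toLin (toQL (realPart A : LocalObs d q Λ))
        - Complex.I * ρ.toLin (toQL (imaginaryPart A : LocalObs d q Λ)) := by
      conv_lhs => rw [← hd, ← toQLHom_apply, star_add, star_smul, (realPart A).2.star_eq,
        (imaginaryPart A).2.star_eq, map_add, map_smul, map_add, map_smul, smul_eq_mul]
      simp only [Complex.star_def, Complex.conj_I, neg_mul, ← sub_eq_add_neg]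
      rfl
    rw [e1, e2, star_add, star_mul', hsa _ (realPart A).2, hsa _ (imaginaryPart A).2]
    simp [sub_eq_add_neg]
  have := h (Matrix.single t s 1)
  rw [Matrix.star_eq_conjTranspose, Matrix.conjTranspose_single, star_one] at this
  simp only [Matrix.conjTranspose_apply, State.marginal, Matrix.of_apply]
  rw [this, star_star]

theorem State.trace_marginal_mul_incl (ρ : State d q) {X Λ : Finset (Site d)} (h : X ⊆ Λ)
    (A : LocalObs d q X) : (ρ.marginal Λ * incl h A).trace = ρ.toLin (toQL A) := by
  rw [ρ.trace_marginal_mul, toQL_incl]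

theorem State.ext_marginal {ρ : State d q} {Λ : Finset (Site d)} {g : LocalObs d q Λ}
    (h : ∀ A : LocalObs d q Λ, ρ.toLin (toQL A) = (g * A).trace) : ρ.marginal Λ = g := by
  ext s t
  rw [State.marginal, Matrix.of_apply, h, Matrix.trace_mul_single]
  simp

/-! ### Extension, translation, averaging and compactness of states -/

theorem sum_mul_inner_nonneg {n H : Type*} [Fintype n] [NormedAddCommGroup H]
    [InnerProductSpace ℂ H] [CompleteSpace H] (B : Matrix n n ℂ) (e : n → H) (T : H →L[ℂ] H) :
    0 ≤ ∑ a, ∑ b, (B.conjTranspose * B) b a * inner ℂ (e a) ((star T * T) (e b)) := by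
  have h2 : ∀ a b, inner ℂ (e a) ((star T * T) (e b)) = inner ℂ (T (e a)) (T (e b)) :=
    fun a b => ContinuousLinearMap.adjoint_inner_right T (e a) (T (e b))
  have h3 : ∀ k, inner ℂ (∑ a, star (B k a) • T (e a)) (∑ b, star (B k b) • T (e b))
      = ∑ a, ∑ b, star (B k b) * B k a * inner ℂ (T (e a)) (T (e b)) := by
    intro k
    rw [sum_inner]
    refine Finset.sum_congr rfl fun a _ => ?_
    rw [inner_sum]
    refine Finset.sum_congr rfl fun b _ => ?_
    rw [inner_smul_left, inner_smul_right, Complex.star_def, Complex.conj_conj]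
    ring
  -- Expanding `B* B` turns the form into `∑_k ‖T v_k‖²` with `v_k = ∑_a conj(B_{ka}) e_a`.
  have h : ∑ a, ∑ b, (B.conjTranspose * B) b a * inner ℂ (e a) ((star T * T) (e b))
      = ∑ k, inner ℂ (∑ a, star (B k a) • T (e a)) (∑ b, star (B k b) • T (e b)) := by
    symm
    rw [Finset.sum_congr rfl fun k _ => h3 k, Finset.sum_comm]
    refine Finset.sum_congr rfl fun a _ => ?_
    rw [Finset.sum_comm]
    refine Finset.sum_congr rfl fun b _ => ?_
    rw [h2, Matrix.mul_apply, Finset.sum_mul]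
    rfl
  rw [h]
  refine Finset.sum_nonneg fun k _ => ?_
  rw [inner_self_eq_norm_sq_to_K]
  exact Complex.zero_le_real.2 (sq_nonneg _) |>.trans_eq (by push_cast; rfl)

/-- Every density matrix of a finite region is the marginal of a state. -/
theorem exists_state_marginal_eq [NeZero q] {Λ : Finset (Site d)} {g : LocalObs d q Λ}
    (hg : g.PosSemidef) (h1 : g.trace = 1) : ∃ ρ : State d q, ρ.marginal Λ = g := by
  classical
  let s₀ : Config d q := fun _ => 0
  -- Outside `Λ` every spin is frozen at `0`: the state built below is `g` tensored with a pure
  -- product state.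
  let e : (Λ → Fin q) → Hil d q := fun a => lp.single 2 (glue a s₀) (1 : ℂ)
  obtain ⟨B, hB⟩ : ∃ B : LocalObs d q Λ, g = B.conjTranspose * B :=
    exists_eq_conjTranspose_mul_self hg
  let f : quasiLocal d q →ₗ[ℂ] ℂ :=
    { toFun := fun T => ∑ a, ∑ b, g b a * inner ℂ (e a) ((T : Hil d q →L[ℂ] Hil d q) (e b))
      map_add' := fun S T => by
        simp [mul_add, Finset.sum_add_distrib]
      map_smul' := fun c T => by
        simp [mul_left_comm, Finset.mul_sum] }
  have hf : ∀ T : quasiLocal d q, f T =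
      ∑ a, ∑ b, g b a * inner ℂ (e a) ((T : Hil d q →L[ℂ] Hil d q) (e b)) := fun _ => rfl
  have hf1 : ∀ A : LocalObs d q Λ, f (toQL A) = (g * A).trace := by
    intro A
    have hin : ∀ a b, inner ℂ (e a) (localEmb Λ A (e b)) = A a b := by
      intro a b
      rw [lp.inner_single_left, localEmb_apply, Finset.sum_eq_single b]
      · simp [e, restr_glue, glue_glue]
      · intro t _ ht
        have : glue t (glue a s₀) ≠ glue b s₀ := by
          intro h'
          apply ht
          rw [← restr_glue t (glue a s₀), h', restr_glue]
        rw [lp.single_apply_ne _ _ _ this, mul_zero]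
      · simp
    rw [hf]
    simp only [Matrix.trace, Matrix.diag, Matrix.mul_apply]
    rw [Finset.sum_comm]
    refine Finset.sum_congr rfl fun b _ => Finset.sum_congr rfl fun a _ => ?_
    rw [← hin a b]
    rfl
  refine ⟨⟨f, ?_, ?_⟩, State.ext_marginal hf1⟩
  · intro T
    rw [hf, hB]
    exact sum_mul_inner_nonneg B e T.1
  · have h2 : toQL (1 : LocalObs d q Λ) = 1 := _root_.map_one (toQLHom Λ)
    rw [← h2, hf1, mul_one, h1]

/-- The translate `ρ ∘ τ_x` of a state. -/
def State.translate (x : Site d) (ρ : State d q) : State d q where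
  toLin := ρ.toLin ∘ₗ ((translateHom x : quasiLocal d q →⋆ₐ[ℂ] quasiLocal d q) :
    quasiLocal d q →ₗ[ℂ] quasiLocal d q)
  nonneg A := by
    change 0 ≤ ρ.toLin (translateHom x (star A * A))
    rw [map_mul, map_star]
    exact ρ.nonneg _
  map_one := by
    change ρ.toLin (translateHom x 1) = 1
    rw [_root_.map_one, ρ.map_one]

theorem State.translate_apply (x : Site d) (ρ : State d q) (A : quasiLocal d q) :
    (ρ.translate x).toLin A = ρ.toLin (QuantumSpin.translate x A) := rfl

/-- The average of the translates of a state. -/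
def State.average (ρ : State d q) (Λ : Finset (Site d)) (hΛ : Λ.Nonempty) : State d q where
  toLin := (Λ.card : ℂ)⁻¹ • ∑ x ∈ Λ, (ρ.translate x).toLin
  nonneg A := by
    rw [LinearMap.smul_apply, LinearMap.sum_apply, smul_eq_mul]
    refine mul_nonneg ?_ (Finset.sum_nonneg fun x _ => (ρ.translate x).nonneg A)
    rw [inv_nonneg]
    exact Nat.cast_nonneg _
  map_one := by
    have : (Λ.card : ℂ) ≠ 0 := by exact_mod_cast hΛ.card_pos.ne'
    simp [State.map_one, this]

theorem State.average_apply (ρ : State d q) (Λ : Finset (Site d)) (hΛ : Λ.Nonempty)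
    (A : quasiLocal d q) : (ρ.average Λ hΛ).toLin A
      = (Λ.card : ℂ)⁻¹ * ∑ x ∈ Λ, ρ.toLin (QuantumSpin.translate x A) := by
  simp only [State.average, LinearMap.smul_apply, LinearMap.sum_apply, smul_eq_mul,
    State.translate_apply]

/-- Compactness of the set of states. -/
theorem exists_state_tendsto {ι : Type*} (U : Ultrafilter ι) (σ : ι → State d q) :
    ∃ ω : State d q, ∀ A, Tendsto (fun i => (σ i).toLin A) U (nhds (ω.toLin A)) := by
  have h : ∀ A, ∃ z : ℂ, Tendsto (fun i => (σ i).toLin A) U (nhds z) := by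
    intro A
    obtain ⟨z, -, hz⟩ := (isCompact_closedBall (0 : ℂ) (2 * ‖A‖)).ultrafilter_le_nhds
      (U.map fun i => (σ i).toLin A) (by
        refine le_principal_iff.2 (mem_map.2 (univ_mem' fun i => ?_))
        simpa using (σ i).norm_apply_le A)
    exact ⟨z, hz⟩
  choose f hf using h
  refine ⟨⟨⟨⟨f, ?_⟩, ?_⟩, ?_, ?_⟩, hf⟩
  · intro A B
    refine tendsto_nhds_unique (hf (A + B)) (((hf A).add (hf B)).congr fun i => ?_)
    rw [map_add]
  · intro c A
    refine tendsto_nhds_unique (hf (c • A)) (((hf A).const_mul c).congr fun i => ?_)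
    rw [map_smul, smul_eq_mul]
  · intro A
    exact ge_of_tendsto' (hf _) fun i => (σ i).nonneg A
  · refine tendsto_nhds_unique (hf 1) ?_
    simp only [State.map_one]
    exact tendsto_const_nhds

/-! ### Boxes -/

theorem mem_box {a : Fin d → ℕ} {x : Site d} :
    x ∈ box a ↔ ∀ i, -(a i : ℤ) ≤ x i ∧ x i < a i := by
  simp [box, Fintype.mem_piFinset]

theorem card_box (a : Fin d → ℕ) : (box a).card = ∏ i, (2 * a i) := by
  rw [box, Fintype.card_piFinset]
  refine Finset.prod_congr rfl fun i _ => ?_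
  rw [Int.card_Ico]
  omega

theorem mem_shiftRegion {x y : Site d} {Λ : Finset (Site d)} :
    y ∈ shiftRegion x Λ ↔ y - x ∈ Λ := by
  simp only [shiftRegion, Finset.mem_map, Equiv.coe_toEmbedding, Equiv.coe_addRight]
  constructor
  · rintro ⟨z, hz, rfl⟩
    simpa using hz
  · intro h
    exact ⟨y - x, h, by simp⟩

theorem card_shiftRegion (x : Site d) (Λ : Finset (Site d)) :
    (shiftRegion x Λ).card = Λ.card :=
  Finset.card_map _

theorem eventually_one_le : ∀ᶠ a : Fin d → ℕ in atTop, ∀ i, 1 ≤ a i :=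
  eventually_ge_atTop (fun _ => 1)

theorem card_box_pos {a : Fin d → ℕ} (ha : ∀ i, 1 ≤ a i) : 0 < (box a).card := by
  rw [card_box]
  exact Finset.prod_pos fun i _ => by have := ha i; omega

theorem tendsto_apply_atTop (i : Fin d) : Tendsto (fun a : Fin d → ℕ => a i) atTop atTop :=
  tendsto_atTop.2 fun n => (eventually_ge_atTop fun _ => n).mono fun _ h => h i

theorem tendsto_const_div_apply (c : ℝ) (i : Fin d) :
    Tendsto (fun a : Fin d → ℕ => c / (2 * a i : ℝ)) atTop (nhds 0) :=
  ((tendsto_natCast_atTop_atTop.comp (tendsto_apply_atTop i)).const_mul_atTop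
    (by norm_num : (0 : ℝ) < 2)).const_div_atTop c

/-- In dimension zero every box is a single point, so `1 ≤ d` is essential. The volume is bounded
below by a single side length. -/
theorem tendsto_const_div_card_box (hd : 1 ≤ d) (c : ℝ) :
    Tendsto (fun a : Fin d → ℕ => c / ((box a).card : ℝ)) atTop (nhds 0) := by
  refine squeeze_zero_norm' ?_ (tendsto_const_div_apply |c| ⟨0, hd⟩)
  filter_upwards [eventually_one_le] with a ha
  rw [norm_div, Real.norm_eq_abs, Real.norm_natCast]
  have h1 : 2 * a ⟨0, hd⟩ ≤ (box a).card := by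
    refine Nat.le_of_dvd (card_box_pos ha) ?_
    rw [card_box]
    exact Finset.dvd_prod_of_mem (fun i => 2 * a i) (Finset.mem_univ _)
  have h2 : 0 < 2 * a ⟨0, hd⟩ := by
    have := ha ⟨0, hd⟩
    omega
  refine div_le_div_of_nonneg_left (abs_nonneg c) (by exact_mod_cast h2) (by exact_mod_cast h1)

/-- The sites of the box from which the translate of `Y` does not fit into the box. -/
def overlap (a : Fin d → ℕ) (Y : Finset (Site d)) : Finset (Site d) :=
  (box a).filter fun x => ¬ shiftRegion x Y ⊆ box a

theorem card_filter_Ico_le (m : ℕ) (k : ℤ) :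
    ((Finset.Ico (-(m : ℤ)) m).filter fun t => ¬ (-(m : ℤ) ≤ k + t ∧ k + t < m)).card
      ≤ k.natAbs := by
  -- The lost points lie at one end of the interval; depending on the sign of `k`, one of the two
  -- intervals on the right is empty.
  have : (Finset.Ico (-(m : ℤ)) m).filter (fun t => ¬ (-(m : ℤ) ≤ k + t ∧ k + t < m))
      ⊆ Finset.Ico (m - k) m ∪ Finset.Ico (-(m : ℤ)) (-m - k) := by
    intro t
    simp only [Finset.mem_filter, Finset.mem_Ico, Finset.mem_union]
    omega
  refine (Finset.card_le_card this).trans ((Finset.card_union_le _ _).trans ?_)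
  rw [Int.card_Ico, Int.card_Ico]
  omega

/-- The bad set is a slab: coordinate `i` takes at most `|y i|` values and the others are free. The
factor `2 * a i` avoids dividing natural numbers. -/
theorem card_filter_box_le (a : Fin d → ℕ) (y : Site d) (i : Fin d) :
    ((box a).filter fun x => ¬ (-(a i : ℤ) ≤ y i + x i ∧ y i + x i < a i)).card * (2 * a i)
      ≤ (y i).natAbs * (box a).card := by
  set F := (Finset.Ico (-(a i : ℤ)) (a i)).filter
    fun t => ¬ (-(a i : ℤ) ≤ y i + t ∧ y i + t < a i) with hF
  have h1 : (box a).filter (fun x => ¬ (-(a i : ℤ) ≤ y i + x i ∧ y i + x i < a i))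
      ⊆ Fintype.piFinset (Function.update (fun j => Finset.Ico (-(a j : ℤ)) (a j)) i F) := by
    intro x hx
    rw [Finset.mem_filter, mem_box] at hx
    rw [Fintype.mem_piFinset]
    intro j
    by_cases hj : j = i
    · subst hj
      rw [Function.update_self, hF, Finset.mem_filter, Finset.mem_Ico]
      exact ⟨hx.1 j, hx.2⟩
    · rw [Function.update_of_ne hj, Finset.mem_Ico]
      exact hx.1 j
  have h2 : (Fintype.piFinset
      (Function.update (fun j => Finset.Ico (-(a j : ℤ)) (a j)) i F)).card
      = F.card * ∏ j ∈ Finset.univ.erase i, (2 * a j) := by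
    rw [Fintype.card_piFinset, ← Finset.mul_prod_erase _ _ (Finset.mem_univ i),
      Function.update_self]
    congr 1
    refine Finset.prod_congr rfl fun j hj => ?_
    rw [Function.update_of_ne (Finset.ne_of_mem_erase hj), Int.card_Ico]
    omega
  have h3 := card_filter_Ico_le (a i) (y i)
  rw [card_box, ← Finset.mul_prod_erase _ _ (Finset.mem_univ i)]
  calc _ ≤ (F.card * ∏ j ∈ Finset.univ.erase i, (2 * a j)) * (2 * a i) :=
        Nat.mul_le_mul_right _ ((Finset.card_le_card h1).trans h2.le)
    _ ≤ ((y i).natAbs * ∏ j ∈ Finset.univ.erase i, (2 * a j)) * (2 * a i) :=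
        Nat.mul_le_mul_right _ (Nat.mul_le_mul_right _ h3)
    _ = _ := by ring

/-- The boxes form a Følner family. -/
theorem tendsto_card_overlap (Y : Finset (Site d)) :
    Tendsto (fun a : Fin d → ℕ => ((overlap a Y).card : ℝ) / ((box a).card : ℝ)) atTop
      (nhds 0) := by
  have hlim : Tendsto (fun a : Fin d → ℕ =>
      ∑ y ∈ Y, ∑ i, ((y i).natAbs : ℝ) / (2 * a i : ℝ)) atTop (nhds 0) := by
    have := tendsto_finsetSum (x := (atTop : Filter (Fin d → ℕ))) Y fun y _ =>
      tendsto_finsetSum (Finset.univ : Finset (Fin d)) fun i _ =>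
        tendsto_const_div_apply ((y i).natAbs : ℝ) i
    simpa using this
  refine squeeze_zero' (Eventually.of_forall fun a => by positivity) ?_ hlim
  filter_upwards [eventually_one_le] with a ha
  have hc : (0 : ℝ) < (box a).card := by exact_mod_cast card_box_pos ha
  have hsub : overlap a Y ⊆ Y.biUnion fun y => Finset.univ.biUnion fun i =>
      (box a).filter fun x => ¬ (-(a i : ℤ) ≤ y i + x i ∧ y i + x i < a i) := by
    intro x hx
    rw [overlap, Finset.mem_filter, Finset.not_subset] at hx
    obtain ⟨hx, z, hz, hza⟩ := hx
    rw [mem_box, not_forall] at hza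
    obtain ⟨i, hi⟩ := hza
    rw [mem_shiftRegion] at hz
    simp only [Finset.mem_biUnion, Finset.mem_filter, Finset.mem_univ, true_and]
    exact ⟨z - x, hz, i, hx, by simpa using hi⟩
  have hle : ((overlap a Y).card : ℝ) ≤ ∑ y ∈ Y, ∑ i,
      (((box a).filter fun x => ¬ (-(a i : ℤ) ≤ y i + x i ∧ y i + x i < a i)).card : ℝ) := by
    have := (Finset.card_le_card hsub).trans (Finset.card_biUnion_le.trans
      (Finset.sum_le_sum fun y _ => Finset.card_biUnion_le))
    exact_mod_cast this
  rw [div_le_iff₀ hc]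
  refine hle.trans ?_
  rw [Finset.sum_mul]
  refine Finset.sum_le_sum fun y _ => ?_
  rw [Finset.sum_mul]
  refine Finset.sum_le_sum fun i _ => ?_
  have hi : (0 : ℝ) < 2 * a i := by
    have := ha i
    positivity
  rw [div_mul_eq_mul_div, le_div_iff₀ hi]
  exact_mod_cast card_filter_box_le a y i

/-- Only the symmetric difference of the box and its translate contributes; its two halves have the
sizes of `overlap a {y}` and `overlap a {-y}`. -/
theorem norm_sum_add_sub_sum_le {E : Type*} [NormedAddCommGroup E] (a : Fin d → ℕ) (y : Site d)
    (f : Site d → E) {M : ℝ} (hf : ∀ x, ‖f x‖ ≤ M) :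
    ‖∑ x ∈ box a, f (x + y) - ∑ x ∈ box a, f x‖
      ≤ M * ((overlap a {y}).card + (overlap a {-y}).card) := by
  have hmem : ∀ z x : Site d, shiftRegion x {z} ⊆ box a ↔ x + z ∈ box a := by
    intro z x
    simp [shiftRegion, add_comm]
  have h1 : ∑ x ∈ box a, f (x + y) = ∑ x ∈ shiftRegion y (box a), f x := by
    rw [shiftRegion, Finset.sum_map]
    rfl
  have h2 : (shiftRegion y (box a) \ box a).card = (overlap a {y}).card := by
    symm
    refine Finset.card_bij (fun x _ => x + y) ?_ ?_ ?_
    · intro x hx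
      rw [overlap, Finset.mem_filter, hmem] at hx
      rw [Finset.mem_sdiff, mem_shiftRegion, add_sub_cancel_right]
      exact hx
    · intro x _ x' _ h
      exact add_right_cancel h
    · intro z hz
      rw [Finset.mem_sdiff, mem_shiftRegion] at hz
      refine ⟨z - y, ?_, sub_add_cancel z y⟩
      rw [overlap, Finset.mem_filter, hmem, sub_add_cancel]
      exact hz
  have h3 : (box a \ shiftRegion y (box a)).card = (overlap a {-y}).card := by
    congr 1
    ext x
    rw [overlap, Finset.mem_filter, hmem, Finset.mem_sdiff, mem_shiftRegion, sub_eq_add_neg]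
  rw [h1, ← Finset.sum_sdiff_sub_sum_sdiff, mul_add, ← h2, ← h3]
  refine (norm_sub_le _ _).trans (add_le_add ?_ ?_)
  · refine (norm_sum_le_of_le _ fun x _ => hf x).trans ?_
    rw [Finset.sum_const, nsmul_eq_mul, mul_comm]
  · refine (norm_sum_le_of_le _ fun x _ => hf x).trans ?_
    rw [Finset.sum_const, nsmul_eq_mul, mul_comm]

/-! ### Tilings -/

theorem entropy_marginal_le [NeZero q] (σ : State d q) (Λ : Finset (Site d)) {K : LocalObs d q Λ}
    (hK : K.IsHermitian) :
    entropy (σ.marginal Λ) ≤ (σ.toLin (toQL K)).re + Real.log (partition K) := by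
  rw [← σ.trace_marginal_mul]
  exact entropy_le (σ.posSemidef_marginal Λ) (σ.trace_marginal Λ) hK

/-- Non-interacting copies of `K` on disjoint tiles form one Hamiltonian whose partition function is
a power of that of `K`. -/
theorem exists_sum_translate [NeZero q] {B : Finset (Site d)} {K : LocalObs d q B}
    (hK : K.IsHermitian) (I : Finset (Site d))
    (hI : (I : Set (Site d)).PairwiseDisjoint fun x => shiftRegion x B) :
    ∃ M : LocalObs d q (I.biUnion fun x => shiftRegion x B), M.IsHermitian ∧
      toQL M = ∑ x ∈ I, translate x (toQL K) ∧ partition M = partition K ^ I.card := by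
  induction I using Finset.induction_on with
  | empty =>
    refine ⟨0, Matrix.isHermitian_zero, ?_, ?_⟩
    · rw [Finset.sum_empty]
      exact map_zero (toQLHom _)
    · rw [partition_zero]
      simp
  | insert x I hx ih =>
    obtain ⟨M, hM, hM2, hM3⟩ := ih (hI.subset (by simp))
    have hd : Disjoint (shiftRegion x B) (I.biUnion fun x => shiftRegion x B) := by
      rw [Finset.disjoint_biUnion_right]
      intro y hy
      exact hI (by simp) (by simp [hy]) (by rintro rfl; exact hx hy)
    have hY : shiftRegion x B ⊆ (insert x I).biUnion fun x => shiftRegion x B :=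
      Finset.subset_biUnion_of_mem (fun x => shiftRegion x B) (Finset.mem_insert_self x I)
    have hZ : (I.biUnion fun x => shiftRegion x B) ⊆
        (insert x I).biUnion fun x => shiftRegion x B :=
      Finset.biUnion_subset_biUnion_of_subset_left _ (Finset.subset_insert x I)
    refine ⟨incl hY (shiftObs x K) + incl hZ M,
      (isHermitian_incl hY (isHermitian_shiftObs x hK)).add (isHermitian_incl hZ hM), ?_, ?_⟩
    · rw [← toQLHom_apply, map_add, toQLHom_apply, toQLHom_apply, toQL_incl, toQL_incl, hM2,
        Finset.sum_insert hx, translate_toQL]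
    · rw [partition_incl_add_incl hY hZ hd (by rw [Finset.biUnion_insert])
        (isHermitian_shiftObs x hK) hM, hM3, partition_shiftObs, Finset.card_insert_of_notMem hx,
        pow_succ, mul_comm]

theorem entropy_marginal_le_sum [NeZero q] (σ : State d q) {Λ B : Finset (Site d)}
    {K : LocalObs d q B} (hK : K.IsHermitian) (I : Finset (Site d))
    (hI : (I : Set (Site d)).PairwiseDisjoint fun x => shiftRegion x B)
    (hIΛ : ∀ x ∈ I, shiftRegion x B ⊆ Λ) :
    entropy (σ.marginal Λ) ≤
      ∑ x ∈ I, ((σ.toLin (translate x (toQL K))).re + Real.log (partition K))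
        + ((Λ.card : ℝ) - I.card * B.card) * Real.log q := by
  obtain ⟨M, hM, hM2, hM3⟩ := exists_sum_translate hK I hI
  set W := I.biUnion fun x => shiftRegion x B with hW
  have hWΛ : W ⊆ Λ := Finset.biUnion_subset.2 hIΛ
  have hZ : Λ \ W ⊆ Λ := Finset.sdiff_subset
  -- The trial Hamiltonian is the tiled copy of `K` on `W` and zero on the uncovered sites, each of
  -- which costs `log q`.
  have h := entropy_marginal_le σ Λ ((isHermitian_incl hWΛ hM).add
    (isHermitian_incl hZ (Matrix.isHermitian_zero (n := (Λ \ W : Finset (Site d)) → Fin q))))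
  rw [partition_incl_add_incl hWΛ hZ Finset.disjoint_sdiff
      (by rw [Finset.union_sdiff_of_subset hWΛ]) hM Matrix.isHermitian_zero,
    partition_zero, hM3, ← toQLHom_apply, map_add, toQLHom_apply, toQLHom_apply, toQL_incl,
    toQL_incl, hM2] at h
  have h0 : toQL (0 : LocalObs d q (Λ \ W)) = 0 := map_zero (toQLHom _)
  have hq : (0 : ℝ) < q := by exact_mod_cast NeZero.pos q
  have hcard : W.card = I.card * B.card := by
    rw [hW, Finset.card_biUnion hI]
    simp [card_shiftRegion]
  have hcard2 : ((Λ \ W).card : ℝ) = (Λ.card : ℝ) - I.card * B.card := by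
    rw [Finset.card_sdiff_of_subset hWΛ, Nat.cast_sub (Finset.card_le_card hWΛ), hcard]
    push_cast
    rfl
  have hp := partition_pos hK
  rw [h0, add_zero, Real.log_mul (by positivity) (by positivity), Real.log_pow, Real.log_pow,
    map_sum, Complex.re_sum, hcard2] at h
  rw [Finset.sum_add_distrib, Finset.sum_const, nsmul_eq_mul]
  linarith

/-- Translates of a box by sites that agree modulo its side lengths are disjoint. -/
theorem disjoint_shiftRegion_box {b : Fin d → ℕ} {x y : Site d} (hxy : x ≠ y)
    (h : ∀ i, x i % (2 * b i : ℕ) = y i % (2 * b i : ℕ)) :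
    Disjoint (shiftRegion x (box b)) (shiftRegion y (box b)) := by
  rw [Finset.disjoint_left]
  intro z hx hy
  apply hxy
  funext i
  rw [mem_shiftRegion, mem_box] at hx hy
  have h1 := hx i
  have h2 := hy i
  simp only [Pi.sub_apply] at h1 h2
  have h3 : ((2 * b i : ℕ) : ℤ) ∣ x i - y i := Int.ModEq.dvd (h i).symm
  have h4 : |x i - y i| < (2 * b i : ℕ) := by
    rw [abs_lt]
    push_cast
    constructor <;> linarith
  have := Int.eq_zero_of_abs_lt_dvd h3 h4
  linarith

/-- The entropy in a large box is controlled by any local observable of a small box, averaged over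
the translations. -/
theorem card_mul_entropy_le [NeZero q] (σ : State d q) {b : Fin d → ℕ} (hb : ∀ i, 1 ≤ b i)
    (a : Fin d → ℕ) {K : LocalObs d q (box b)} (hK : K.IsHermitian) :
    (box b).card * entropy (σ.marginal (box a)) ≤
      ∑ x ∈ box a, ((σ.toLin (translate x (toQL K))).re + Real.log (partition K))
        + (overlap a (box b)).card *
          (2 * opNorm K + |Real.log (partition K)| + (box b).card * Real.log q) := by
  classical
  set f : Site d → ℝ := fun x => (σ.toLin (translate x (toQL K))).re + Real.log (partition K)
  let G := (box a).filter fun x => shiftRegion x (box b) ⊆ box a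
  -- Positions in the same residue class modulo the side lengths give disjoint tiles. There are
  -- `|box b|` classes, one tiling for each, and summing over them lets every admissible position
  -- occur once.
  let cls : Site d → Site d := fun x i => x i % (2 * b i : ℕ)
  let C : Finset (Site d) := Fintype.piFinset fun i => Finset.Ico 0 ((2 * b i : ℕ) : ℤ)
  have hC : C.card = (box b).card := by
    rw [Fintype.card_piFinset, card_box]
    refine Finset.prod_congr rfl fun i _ => ?_
    rw [Int.card_Ico]
    omega
  have hcls : ∀ x ∈ G, cls x ∈ C := by
    intro x _
    rw [Fintype.mem_piFinset]
    intro i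
    have : (0 : ℤ) < (2 * b i : ℕ) := by
      have := hb i
      exact_mod_cast (by omega : 0 < 2 * b i)
    exact Finset.mem_Ico.2 ⟨Int.emod_nonneg _ this.ne', Int.emod_lt_of_pos _ this⟩
  have hc : ∀ c ∈ C, entropy (σ.marginal (box a)) ≤ ∑ x ∈ G with cls x = c, f x
      + (((box a).card : ℝ) - (G.filter fun x => cls x = c).card * (box b).card) * Real.log q := by
    intro c _
    refine entropy_marginal_le_sum σ hK _ ?_ ?_
    · intro x hx y hy hxy
      simp only [Finset.coe_filter, Set.mem_ofPred_eq] at hx hy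
      exact disjoint_shiftRegion_box hxy fun i => congrFun (hx.2.trans hy.2.symm) i
    · intro x hx
      exact (Finset.mem_filter.1 (Finset.mem_filter.1 hx).1).2
  have hsum := Finset.sum_le_sum hc
  rw [Finset.sum_const, nsmul_eq_mul, hC, Finset.sum_add_distrib, ← Finset.sum_mul,
    Finset.sum_sub_distrib, Finset.sum_const, nsmul_eq_mul, hC, ← Finset.sum_mul,
    Finset.sum_fiberwise_of_maps_to hcls, ← Nat.cast_sum,
    ← Finset.card_eq_sum_card_fiberwise hcls] at hsum
  have hsplit : ∑ x ∈ G, f x + ∑ x ∈ overlap a (box b), f x = ∑ x ∈ box a, f x :=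
    Finset.sum_filter_add_sum_filter_not _ _ _
  have hcard : (G.card : ℝ) + (overlap a (box b)).card = (box a).card := by
    exact_mod_cast Finset.card_filter_add_card_filter_not (s := box a) _
  -- Positions whose tile leaves the large box occur in no tiling; adding them to complete the sum
  -- costs at most this much each.
  have hbad : -∑ x ∈ overlap a (box b), f x ≤ (overlap a (box b)).card *
      (2 * opNorm K + |Real.log (partition K)|) := by
    rw [← Finset.sum_neg_distrib, ← nsmul_eq_mul]
    refine Finset.sum_le_card_nsmul _ _ _ fun x _ => ?_
    have h1 : ‖σ.toLin (translate x (toQL K))‖ ≤ 2 * opNorm K := by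
      refine (σ.norm_apply_le _).trans ?_
      rw [← norm_toQL]
      exact mul_le_mul_of_nonneg_left (norm_translate_le x _) zero_le_two
    have h2 := (abs_le.1 (Complex.abs_re_le_norm (σ.toLin (translate x (toQL K))))).1
    have h3 := neg_abs_le (Real.log (partition K))
    simp only [f]
    linarith
  -- The total number of uncovered sites over all the tilings.
  have e : ((box b).card : ℝ) * (box a).card - G.card * (box b).card
      = (overlap a (box b)).card * (box b).card := by
    rw [← hcard]
    ring
  rw [e] at hsum
  linarith

/-! ### The specific entropy -/

theorem entropy_marginal_nonneg [NeZero q] (σ : State d q) (Λ : Finset (Site d)) :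
    0 ≤ entropy (σ.marginal Λ) :=
  entropy_nonneg (σ.posSemidef_marginal Λ) (σ.trace_marginal Λ)

theorem entropy_marginal_le_card [NeZero q] (σ : State d q) (Λ : Finset (Site d)) :
    entropy (σ.marginal Λ) ≤ Λ.card * Real.log q := by
  have h := entropy_marginal_le σ Λ (K := 0) Matrix.isHermitian_zero
  have h0 : toQL (0 : LocalObs d q Λ) = 0 := map_zero (toQLHom _)
  rwa [h0, map_zero, Complex.zero_re, zero_add, partition_zero, Real.log_pow] at h

theorem entropy_density_mem [NeZero q] (σ : State d q) (a : Fin d → ℕ) :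
    entropy (σ.marginal (box a)) / ((box a).card : ℝ) ∈ Set.Icc 0 (Real.log q) := by
  refine ⟨div_nonneg (entropy_marginal_nonneg σ _) (Nat.cast_nonneg _), ?_⟩
  have hq : 0 ≤ Real.log q := Real.log_natCast_nonneg q
  refine div_le_of_le_mul₀ (Nat.cast_nonneg _) hq ?_
  rw [mul_comm]
  exact entropy_marginal_le_card σ _

/-- The entropy is upper semicontinuous under averaging over growing boxes. -/
theorem mul_card_le_entropy_marginal [NeZero q] {F : Filter (Fin d → ℕ)} [F.NeBot]
    (hF : F ≤ atTop) {σ : (Fin d → ℕ) → State d q} {ω : State d q}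
    (hω : ∀ A, Tendsto (fun a => ((box a).card : ℂ)⁻¹ *
      ∑ x ∈ box a, (σ a).toLin (translate x A)) F (nhds (ω.toLin A)))
    {L : ℝ} (hL : Tendsto (fun a => entropy ((σ a).marginal (box a)) / ((box a).card : ℝ)) F
      (nhds L)) {b : Fin d → ℕ} (hb : ∀ i, 1 ≤ b i) :
    (box b).card * L ≤ entropy (ω.marginal (box b)) := by
  -- By sharpness of the variational formula it suffices to test one fixed `K` at a time. For fixed
  -- `K` only convergence of expectations is needed, and the boundary term vanishes by the Følner
  -- property.
  refine le_entropy (ω.posSemidef_marginal _) (ω.trace_marginal _) fun K hK => ?_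
  rw [ω.trace_marginal_mul]
  set C := 2 * opNorm K + |Real.log (partition K)| + (box b).card * Real.log q with hC
  have h1 := hL.const_mul ((box b).card : ℝ)
  have h2 : Tendsto (fun a => (((box a).card : ℂ)⁻¹ *
      ∑ x ∈ box a, (σ a).toLin (translate x (toQL K))).re + Real.log (partition K)
      + ((overlap a (box b)).card : ℝ) / ((box a).card : ℝ) * C) F
      (nhds ((ω.toLin (toQL K)).re + Real.log (partition K) + 0 * C)) :=
    (((Complex.continuous_re.tendsto _).comp (hω (toQL K))).add_const _).add
      (((tendsto_card_overlap (box b)).mono_left hF).mul_const C)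
  rw [zero_mul, add_zero] at h2
  refine le_of_tendsto_of_tendsto h1 h2 ?_
  filter_upwards [hF eventually_one_le] with a ha
  have hc : (0 : ℝ) < (box a).card := by exact_mod_cast card_box_pos ha
  have h := card_mul_entropy_le (σ a) hb a hK
  rw [Finset.sum_add_distrib, Finset.sum_const, nsmul_eq_mul, ← hC] at h
  have e : (((box a).card : ℂ)⁻¹ * ∑ x ∈ box a, (σ a).toLin (translate x (toQL K))).re
      = (∑ x ∈ box a, ((σ a).toLin (translate x (toQL K))).re) / (box a).card := by
    rw [← Complex.ofReal_natCast, ← Complex.ofReal_inv, Complex.re_ofReal_mul, Complex.re_sum,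
      inv_mul_eq_div]
  rw [e, mul_div_assoc', div_mul_eq_mul_div, div_add' _ _ _ hc.ne', ← add_div,
    div_le_div_iff_of_pos_right hc]
  linarith

/-- The limsup of a bounded function is a cluster point. Ultrafilters replace subsequences and also
give limits of states through `exists_state_tendsto`. -/
theorem exists_ultrafilter_tendsto_limsup {ι : Type*} {F : Filter ι} [F.NeBot] {u : ι → ℝ}
    {m M : ℝ} (h : ∀ᶠ i in F, u i ∈ Set.Icc m M) :
    ∃ U : Ultrafilter ι, ↑U ≤ F ∧ Tendsto u U (nhds (limsup u F)) := by
  have hb : F.IsBoundedUnder (· ≤ ·) u := isBoundedUnder_of_eventually_le (h.mono fun _ h => h.2)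
  have hb' : F.IsBoundedUnder (· ≥ ·) u := isBoundedUnder_of_eventually_ge (h.mono fun _ h => h.1)
  refine mapClusterPt_iff_ultrafilter.1 ?_
  rw [mapClusterPt_iff_frequently]
  intro s hs
  obtain ⟨ε, hε, hsub⟩ := Metric.mem_nhds_iff.1 hs
  have h1 : ∃ᶠ i in F, limsup u F - ε < u i :=
    frequently_lt_of_lt_limsup hb'.isCoboundedUnder_le (by linarith)
  have h2 : ∀ᶠ i in F, u i < limsup u F + ε :=
    eventually_lt_of_limsup_lt (by linarith) hb
  refine (h1.and_eventually h2).mono fun i hi => hsub ?_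
  rw [Metric.mem_ball, Real.dist_eq, abs_lt]
  constructor <;> linarith [hi.1, hi.2]

theorem isBoundedUnder_entropy_density [NeZero q] (ρ : State d q) :
    (atTop : Filter (Fin d → ℕ)).IsBoundedUnder (· ≤ ·)
      (fun a => entropy (ρ.marginal (box a)) / ((box a).card : ℝ)) ∧
    (atTop : Filter (Fin d → ℕ)).IsBoundedUnder (· ≥ ·)
      (fun a => entropy (ρ.marginal (box a)) / ((box a).card : ℝ)) :=
  ⟨isBoundedUnder_of_eventually_le (.of_forall fun a => (entropy_density_mem ρ a).2),
    isBoundedUnder_of_eventually_ge (.of_forall fun a => (entropy_density_mem ρ a).1)⟩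

theorem average_translate_of_isInvariant {ρ : State d q} (hρ : ρ.IsInvariant) {a : Fin d → ℕ}
    (ha : ∀ i, 1 ≤ a i) (A : quasiLocal d q) :
    ((box a).card : ℂ)⁻¹ * ∑ x ∈ box a, ρ.toLin (translate x A) = ρ.toLin A := by
  have : ((box a).card : ℂ) ≠ 0 := by exact_mod_cast (card_box_pos ha).ne'
  simp [hρ _ A, this]

/-- The specific entropy of a translation-invariant state is a limit. -/
theorem tendsto_entropy_density [NeZero q] {ρ : State d q} (hρ : ρ.IsInvariant) :
    Tendsto (fun a => entropy (ρ.marginal (box a)) / ((box a).card : ℝ)) atTop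
      (nhds (specificEntropy ρ)) := by
  obtain ⟨hb, hb'⟩ := isBoundedUnder_entropy_density ρ
  obtain ⟨U, hU, hlim⟩ := exists_ultrafilter_tendsto_limsup (F := atTop)
    (.of_forall fun a => entropy_density_mem ρ a)
  refine tendsto_of_le_liminf_of_limsup_le ?_ le_rfl hb hb'
  refine le_liminf_of_le hb.isCoboundedUnder_ge ?_
  filter_upwards [eventually_one_le] with b hbb
  have hc : (0 : ℝ) < (box b).card := by exact_mod_cast card_box_pos hbb
  rw [le_div_iff₀ hc, mul_comm]
  -- For the constant family the averages are `ρ` itself, so each single density is at least the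
  -- limsup and the liminf equals it.
  refine mul_card_le_entropy_marginal hU (σ := fun _ => ρ) (fun A => ?_) hlim hbb
  refine tendsto_const_nhds.congr' ?_
  filter_upwards [hU eventually_one_le] with a ha
  exact (average_translate_of_isInvariant hρ ha A).symm

/-! ### The specific energy -/

/-- The translations as continuous linear maps. -/
def translateCLM (x : Site d) : quasiLocal d q →L[ℂ] quasiLocal d q :=
  LinearMap.mkContinuous ((translateHom x : quasiLocal d q →⋆ₐ[ℂ] quasiLocal d q) :
    quasiLocal d q →ₗ[ℂ] quasiLocal d q) 1 fun A => by
      rw [one_mul]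
      exact norm_translate_le x A

instance : CompleteSpace (quasiLocal d q) := isClosed_quasiLocal.completeSpace_coe

variable {Φ : Interaction d q} {r : ℝ}

theorem opNorm_nonneg {Λ : Finset (Site d)} (A : LocalObs d q Λ) : 0 ≤ opNorm A := norm_nonneg _

theorem Interaction.MemB.translate_term (hΦ : Φ.MemB r) (x : Site d) (X : Finset (Site d)) :
    translate x (toQL (Φ.term X)) = toQL (Φ.term (shiftRegion x X)) := by
  rw [translate_toQL, hΦ.1]

theorem Interaction.MemB.summable_opNorm (hr : 0 < r) (hΦ : Φ.MemB r) :
    Summable fun Λ : {Λ : Finset (Site d) // 0 ∈ Λ} => opNorm (Φ.term Λ.1) := by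
  refine Summable.of_nonneg_of_le (fun _ => opNorm_nonneg _) (fun Λ => ?_) hΦ.2
  refine le_mul_of_one_le_left (opNorm_nonneg _) (Real.one_le_exp ?_)
  have : 1 ≤ Λ.1.card := Finset.card_pos.2 ⟨0, Λ.2⟩
  have : (1 : ℝ) ≤ Λ.1.card := by exact_mod_cast this
  exact mul_nonneg hr.le (by linarith)

theorem norm_inv_card_smul_le [NeZero q] (n : ℕ) {X : Finset (Site d)} (A : LocalObs d q X) :
    ‖(n : ℂ)⁻¹ • toQL A‖ ≤ opNorm A := by
  rw [norm_smul, norm_toQL, norm_inv, Complex.norm_natCast]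
  refine mul_le_of_le_one_left (opNorm_nonneg _) ?_
  rcases Nat.eq_zero_or_pos n with rfl | hn
  · simp
  · exact inv_le_one_of_one_le₀ (by exact_mod_cast hn)

theorem Interaction.MemB.hasSum_energyObs [NeZero q] (hr : 0 < r) (hΦ : Φ.MemB r) :
    HasSum (fun Λ : {Λ : Finset (Site d) // 0 ∈ Λ} => (Λ.1.card : ℂ)⁻¹ • toQL (Φ.term Λ.1))
      Φ.energyObs :=
  (Summable.of_norm_bounded (hΦ.summable_opNorm hr) fun _ => norm_inv_card_smul_le _ _).hasSum

theorem Interaction.isHermitian_hamiltonian [NeZero q] (Φ : Interaction d q)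
    (Λ : Finset (Site d)) : (Φ.hamiltonian Λ).IsHermitian := by
  rw [Interaction.hamiltonian, Matrix.IsHermitian, Matrix.conjTranspose_sum]
  exact Finset.sum_congr rfl fun X _ => isHermitian_incl _ (Φ.isHermitian X.1)

theorem Interaction.toQL_hamiltonian (Φ : Interaction d q) (Λ : Finset (Site d)) :
    toQL (Φ.hamiltonian Λ) = ∑ X ∈ Λ.powerset, toQL (Φ.term X) := by
  rw [Interaction.hamiltonian, ← toQLHom_apply, map_sum,
    ← Finset.sum_attach Λ.powerset fun X => toQL (Φ.term X)]
  exact Finset.sum_congr rfl fun X _ => toQL_incl _ _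

/-- Each nonempty `X` is shared equally among its sites. The empty region has no site: it occurs in
the Hamiltonian but not in `E_Φ`, and is kept apart as a constant. -/
theorem Interaction.toQL_hamiltonian_eq (Φ : Interaction d q) (Λ : Finset (Site d)) :
    toQL (Φ.hamiltonian Λ) = toQL (Φ.term ∅) +
      ∑ x ∈ Λ, ∑ X ∈ Λ.powerset, if x ∈ X then (X.card : ℂ)⁻¹ • toQL (Φ.term X) else 0 := by
  classical
  rw [Finset.sum_comm, Φ.toQL_hamiltonian]
  have h : ∀ X ∈ Λ.powerset, (∑ x ∈ Λ, if x ∈ X then (X.card : ℂ)⁻¹ • toQL (Φ.term X) else 0)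
      = toQL (Φ.term X) - if X = ∅ then toQL (Φ.term X) else 0 := by
    intro X hX
    rw [← Finset.sum_filter, Finset.filter_mem_eq_inter,
      Finset.inter_eq_right.2 (Finset.mem_powerset.1 hX), Finset.sum_const,
      ← Nat.cast_smul_eq_nsmul ℂ, smul_smul]
    by_cases h0 : X = ∅
    · simp [h0]
    · have : (X.card : ℂ) ≠ 0 := by
        exact_mod_cast (Finset.card_pos.2 (Finset.nonempty_iff_ne_empty.2 h0)).ne'
      rw [mul_inv_cancel₀ this, one_smul, if_neg h0, sub_zero]
  rw [Finset.sum_congr rfl h, Finset.sum_sub_distrib, Finset.sum_ite_eq' , if_pos (by simp)]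
  abel

/-- Regions containing `x` are exactly the translates by `x` of the regions containing the origin.
-/
theorem Interaction.MemB.hasSum_translate_energyObs_inside (hΦ : Φ.MemB r)
    (Λ : Finset (Site d)) (x : Site d) :
    HasSum (fun Y : {Y : Finset (Site d) // 0 ∈ Y} => if shiftRegion x Y.1 ⊆ Λ then
      translate x ((Y.1.card : ℂ)⁻¹ • toQL (Φ.term Y.1)) else 0)
      (∑ X ∈ Λ.powerset, if x ∈ X then (X.card : ℂ)⁻¹ • toQL (Φ.term X) else 0) := by
  classical
  let f : Finset (Site d) → quasiLocal d q := fun X =>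
    if X ⊆ Λ then (if x ∈ X then (X.card : ℂ)⁻¹ • toQL (Φ.term X) else 0) else 0
  let g : {Y : Finset (Site d) // 0 ∈ Y} → Finset (Site d) := fun Y => shiftRegion x Y.1
  have hg : Function.Injective g := fun Y Y' h => Subtype.ext (Finset.map_injective _ h)
  have hf : ∀ X, X ∉ Set.range g → f X = 0 := by
    intro X hX
    by_cases hx : x ∈ X
    · refine absurd ⟨⟨shiftRegion (-x) X, ?_⟩, ?_⟩ hX
      · rw [mem_shiftRegion]
        simpa using hx
      · ext z
        simp only [g, mem_shiftRegion]
        simp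
    · simp [f, hx]
  have h1 : HasSum f (∑ X ∈ Λ.powerset, f X) :=
    hasSum_sum_of_ne_finset_zero fun X hX => if_neg fun h => hX (Finset.mem_powerset.2 h)
  have h2 : ∑ X ∈ Λ.powerset, f X
      = ∑ X ∈ Λ.powerset, if x ∈ X then (X.card : ℂ)⁻¹ • toQL (Φ.term X) else 0 :=
    Finset.sum_congr rfl fun X hX => if_pos (Finset.mem_powerset.1 hX)
  rw [← h2]
  convert (hg.hasSum_iff hf).2 h1 using 2 with Y
  simp only [Function.comp_apply, f, g]
  have hx : x ∈ shiftRegion x Y.1 := by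
    rw [mem_shiftRegion, sub_self]
    exact Y.2
  by_cases hY : shiftRegion x Y.1 ⊆ Λ
  · rw [if_pos hY, if_pos hY, if_pos hx, ← translateHom_apply, map_smul, translateHom_apply,
      hΦ.translate_term, card_shiftRegion]
  · rw [if_neg hY, if_neg hY]

/-- Apart from `Φ(∅)`, the difference collects, for each shape `Y`, the translates based in the box
that stick out of it. -/
theorem Interaction.MemB.norm_hamiltonian_sub_le [NeZero q] (hr : 0 < r) (hΦ : Φ.MemB r)
    (a : Fin d → ℕ) :
    ‖toQL (Φ.hamiltonian (box a)) - ∑ x ∈ box a, translate x Φ.energyObs‖ ≤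
      opNorm (Φ.term ∅) + ∑' Y : {Y : Finset (Site d) // 0 ∈ Y},
        opNorm (Φ.term Y.1) * (overlap a Y.1).card := by
  have hs := hΦ.summable_opNorm hr
  have h1 : ∀ x, HasSum (fun Y : {Y : Finset (Site d) // 0 ∈ Y} =>
      if shiftRegion x Y.1 ⊆ box a then 0 else
        translate x ((Y.1.card : ℂ)⁻¹ • toQL (Φ.term Y.1)))
      (translate x Φ.energyObs -
        ∑ X ∈ (box a).powerset, if x ∈ X then (X.card : ℂ)⁻¹ • toQL (Φ.term X) else 0) := by
    intro x
    have := ((hΦ.hasSum_energyObs hr).mapL (translateCLM x)).sub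
      (hΦ.hasSum_translate_energyObs_inside (box a) x)
    refine this.congr_fun fun Y => ?_
    split_ifs
    · exact (sub_self _).symm
    · exact (sub_zero _).symm
  have h2 := hasSum_sum fun x (_ : x ∈ box a) => h1 x
  rw [Finset.sum_sub_distrib] at h2
  have hbd : ∀ Y : {Y : Finset (Site d) // 0 ∈ Y},
      ‖∑ x ∈ box a, if shiftRegion x Y.1 ⊆ box a then 0 else
        translate x ((Y.1.card : ℂ)⁻¹ • toQL (Φ.term Y.1))‖
      ≤ opNorm (Φ.term Y.1) * (overlap a Y.1).card := by
    intro Y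
    have : (∑ x ∈ box a, if shiftRegion x Y.1 ⊆ box a then 0 else
        translate x ((Y.1.card : ℂ)⁻¹ • toQL (Φ.term Y.1)))
        = ∑ x ∈ overlap a Y.1, translate x ((Y.1.card : ℂ)⁻¹ • toQL (Φ.term Y.1)) := by
      rw [overlap, Finset.sum_filter]
      exact Finset.sum_congr rfl fun x _ => by split_ifs <;> simp_all
    rw [this]
    refine (norm_sum_le_of_le _ fun x _ =>
      (norm_translate_le x _).trans (norm_inv_card_smul_le _ _)).trans ?_
    rw [Finset.sum_const, nsmul_eq_mul, mul_comm]
  have hsum : Summable fun Y : {Y : Finset (Site d) // 0 ∈ Y} =>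
      opNorm (Φ.term Y.1) * ((overlap a Y.1).card : ℝ) := by
    refine Summable.of_nonneg_of_le (fun Y => mul_nonneg (opNorm_nonneg _) (Nat.cast_nonneg _))
      (fun Y => ?_) (hs.mul_right ((box a).card : ℝ))
    exact mul_le_mul_of_nonneg_left
      (by exact_mod_cast Finset.card_le_card (Finset.filter_subset _ _)) (opNorm_nonneg _)
  have h3 := tsum_of_norm_bounded hsum.hasSum hbd
  rw [h2.tsum_eq] at h3
  rw [Φ.toQL_hamiltonian_eq, ← norm_toQL, add_sub_assoc]
  refine (norm_add_le _ _).trans (add_le_add le_rfl ?_)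
  rwa [norm_sub_rev]

/-- The local Hamiltonians are asymptotically the sums of the translates of the specific energy
observable. -/
theorem Interaction.MemB.tendsto_norm_hamiltonian_sub [NeZero q] (hd : 1 ≤ d) (hr : 0 < r)
    (hΦ : Φ.MemB r) :
    Tendsto (fun a => ‖toQL (Φ.hamiltonian (box a)) - ∑ x ∈ box a, translate x Φ.energyObs‖ /
      ((box a).card : ℝ)) atTop (nhds 0) := by
  have hs := hΦ.summable_opNorm hr
  have h1 : Tendsto (fun a : Fin d → ℕ => ∑' Y : {Y : Finset (Site d) // 0 ∈ Y},
      opNorm (Φ.term Y.1) * (((overlap a Y.1).card : ℝ) / ((box a).card : ℝ))) atTop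
      (nhds (∑' Y : {Y : Finset (Site d) // 0 ∈ Y}, opNorm (Φ.term Y.1) * 0)) := by
    -- For each shape the boundary fraction tends to zero and is at most one, so the summable norms
    -- dominate.
    refine tendsto_tsum_of_dominated_convergence hs
      (fun Y => (tendsto_card_overlap Y.1).const_mul _) (.of_forall fun a Y => ?_)
    have hle : ((overlap a Y.1).card : ℝ) ≤ (box a).card := by
      exact_mod_cast Finset.card_le_card (Finset.filter_subset _ _)
    rw [norm_mul, Real.norm_of_nonneg (opNorm_nonneg _), Real.norm_of_nonneg (by positivity)]
    exact mul_le_of_le_one_right (opNorm_nonneg _) (div_le_one_of_le₀ hle (Nat.cast_nonneg _))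
  have h2 := (tendsto_const_div_card_box hd (opNorm (Φ.term ∅))).add h1
  simp only [mul_zero, tsum_zero, add_zero] at h2
  refine squeeze_zero (fun a => by positivity) (fun a => ?_) h2
  refine (div_le_div_of_nonneg_right (hΦ.norm_hamiltonian_sub_le hr a)
    (Nat.cast_nonneg _)).trans (le_of_eq ?_)
  rw [add_div, ← tsum_div_const]
  simp only [mul_div_assoc]

/-! ### The Gibbs variational principle -/

theorem Interaction.MemB.abs_energy_sub_le [NeZero q] (σ : State d q) (a : Fin d → ℕ) :
    |((σ.marginal (box a) * Φ.hamiltonian (box a)).trace.re / ((box a).card : ℝ)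
      - (((box a).card : ℂ)⁻¹ * ∑ x ∈ box a, σ.toLin (translate x Φ.energyObs)).re)| ≤
    2 * (‖toQL (Φ.hamiltonian (box a)) - ∑ x ∈ box a, translate x Φ.energyObs‖ /
      ((box a).card : ℝ)) := by
  rw [σ.trace_marginal_mul, ← Complex.ofReal_natCast, ← Complex.ofReal_inv, Complex.re_ofReal_mul,
    inv_mul_eq_div, ← sub_div, ← Complex.sub_re, ← map_sum, ← map_sub, abs_div, Nat.abs_cast,
    ← mul_div_assoc]
  exact div_le_div_of_nonneg_right ((Complex.abs_re_le_norm _).trans (σ.norm_apply_le _))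
    (Nat.cast_nonneg _)

theorem Interaction.MemB.tendsto_energy_sub [NeZero q] (hd : 1 ≤ d) (hr : 0 < r) (hΦ : Φ.MemB r)
    (σ : (Fin d → ℕ) → State d q) :
    Tendsto (fun a => ((σ a).marginal (box a) * Φ.hamiltonian (box a)).trace.re / ((box a).card : ℝ)
      - (((box a).card : ℂ)⁻¹ * ∑ x ∈ box a, (σ a).toLin (translate x Φ.energyObs)).re) atTop
      (nhds 0) := by
  have h := (hΦ.tendsto_norm_hamiltonian_sub hd hr).const_mul 2
  rw [mul_zero] at h
  exact squeeze_zero_norm (fun a => Interaction.MemB.abs_energy_sub_le (σ a) a) h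

theorem Interaction.MemB.tendsto_energy [NeZero q] (hd : 1 ≤ d) (hr : 0 < r) (hΦ : Φ.MemB r)
    {ρ : State d q} (hρ : ρ.IsInvariant) :
    Tendsto (fun a => (ρ.marginal (box a) * Φ.hamiltonian (box a)).trace.re / ((box a).card : ℝ))
      atTop (nhds (ρ.toLin Φ.energyObs).re) := by
  have h := (hΦ.tendsto_energy_sub hd hr fun _ => ρ).add_const (ρ.toLin Φ.energyObs).re
  rw [zero_add] at h
  refine h.congr' ?_
  filter_upwards [eventually_one_le] with a ha
  rw [average_translate_of_isInvariant hρ ha, sub_add_cancel]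

/-- The finite-volume pressure. -/
def Interaction.pressure (Φ : Interaction d q) (a : Fin d → ℕ) : ℝ :=
  Real.log (partition (Φ.hamiltonian (box a))) / ((box a).card : ℝ)

theorem Interaction.exists_gibbsState [NeZero q] (Φ : Interaction d q) (a : Fin d → ℕ) :
    ∃ σ : State d q, σ.marginal (box a) = Φ.localGibbs (box a) :=
  exists_state_marginal_eq (posSemidef_gibbs (Φ.isHermitian_hamiltonian _))
    (trace_gibbs (Φ.isHermitian_hamiltonian _))

theorem Interaction.pressure_eq [NeZero q] {σ : State d q} {a : Fin d → ℕ}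
    (hσ : σ.marginal (box a) = Φ.localGibbs (box a)) :
    Φ.pressure a = entropy (σ.marginal (box a)) / ((box a).card : ℝ) -
      (σ.marginal (box a) * Φ.hamiltonian (box a)).trace.re / ((box a).card : ℝ) := by
  rw [hσ, Interaction.localGibbs, entropy_gibbs (Φ.isHermitian_hamiltonian _),
    Interaction.pressure, ← sub_div, add_sub_cancel_left]

theorem Interaction.relEntropy_div_card [NeZero q] (Φ : Interaction d q) (ρ : State d q)
    (a : Fin d → ℕ) :
    relEntropy (ρ.marginal (box a)) (Φ.localGibbs (box a)) / ((box a).card : ℝ) =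
      -(entropy (ρ.marginal (box a)) / ((box a).card : ℝ)) +
      (ρ.marginal (box a) * Φ.hamiltonian (box a)).trace.re / ((box a).card : ℝ) +
      Φ.pressure a := by
  rw [Interaction.localGibbs, relEntropy_gibbs (ρ.trace_marginal _) (Φ.isHermitian_hamiltonian _),
    add_div, add_div, neg_div]
  rfl

/-- A real `limsup` is meaningful only under boundedness. The pressure is entropy density minus
energy density of the local Gibbs state: the former lies in `[0, log q]`, the latter within `2‖E_Φ‖`
plus an eventual error of one. -/
theorem Interaction.MemB.exists_pressure_mem [NeZero q] (hd : 1 ≤ d) (hr : 0 < r)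
    (hΦ : Φ.MemB r) : ∃ m M : ℝ, ∀ᶠ a in atTop, Φ.pressure a ∈ Set.Icc m M := by
  choose σ hσ using Φ.exists_gibbsState
  refine ⟨-(2 * ‖Φ.energyObs‖ + 1), Real.log q + (2 * ‖Φ.energyObs‖ + 1), ?_⟩
  have h := hΦ.tendsto_energy_sub hd hr σ
  filter_upwards [eventually_one_le, (Metric.tendsto_nhds.1 h 1 one_pos)] with a ha h1
  have hc : (0 : ℝ) < (box a).card := by exact_mod_cast card_box_pos ha
  have h2 : |(((box a).card : ℂ)⁻¹ *
      ∑ x ∈ box a, (σ a).toLin (translate x Φ.energyObs)).re| ≤ 2 * ‖Φ.energyObs‖ := by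
    refine (Complex.abs_re_le_norm _).trans ?_
    rw [norm_mul, norm_inv, Complex.norm_natCast, inv_mul_le_iff₀ hc]
    refine (norm_sum_le_of_le _ fun x _ => ((σ a).norm_apply_le _).trans
      (mul_le_mul_of_nonneg_left (norm_translate_le x _) zero_le_two)).trans ?_
    rw [Finset.sum_const, nsmul_eq_mul]
  have h3 := entropy_density_mem (σ a) a
  rw [Interaction.pressure_eq (hσ a)]
  rw [dist_zero_right, Real.norm_eq_abs] at h1
  have h4 := abs_lt.1 h1
  have h5 := abs_le.1 h2
  constructor <;> linarith [h3.1, h3.2, h4.1, h4.2, h5.1, h5.2]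

/-- A weak limit of averages over growing boxes is translation invariant. -/
theorem isInvariant_of_tendsto_average {F : Filter (Fin d → ℕ)} [F.NeBot] (hF : F ≤ atTop)
    {σ : (Fin d → ℕ) → State d q} {ω : State d q}
    (hω : ∀ A, Tendsto (fun a => ((box a).card : ℂ)⁻¹ *
      ∑ x ∈ box a, (σ a).toLin (translate x A)) F (nhds (ω.toLin A))) : ω.IsInvariant := by
  intro y A
  have h1 := (hω (translate y A)).sub (hω A)
  refine sub_eq_zero.1 (tendsto_nhds_unique h1 ?_)
  have h2 : Tendsto (fun a : Fin d → ℕ => 2 * ‖A‖ *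
      (((overlap a {y}).card : ℝ) / ((box a).card : ℝ)
        + ((overlap a {-y}).card : ℝ) / ((box a).card : ℝ))) F (nhds (2 * ‖A‖ * (0 + 0))) :=
    (((tendsto_card_overlap {y}).add (tendsto_card_overlap {-y})).const_mul _).mono_left hF
  rw [add_zero, mul_zero] at h2
  refine squeeze_zero_norm (fun a => ?_) h2
  rw [← mul_sub, norm_mul, norm_inv, Complex.norm_natCast, ← add_div, ← mul_div_assoc,
    inv_mul_eq_div]
  refine div_le_div_of_nonneg_right ?_ (Nat.cast_nonneg _)
  have h3 := norm_sum_add_sub_sum_le a y (fun x => (σ a).toLin (translate x A))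
    (M := 2 * ‖A‖) fun x => ((σ a).norm_apply_le _).trans
      (mul_le_mul_of_nonneg_left (norm_translate_le x A) zero_le_two)
  simpa only [translate_translate] using h3

/-- There is a translation-invariant state with maximal free energy density. -/
theorem Interaction.MemB.exists_limsup_pressure_le [NeZero q] (hd : 1 ≤ d) (hr : 0 < r)
    (hΦ : Φ.MemB r) : ∃ ω : State d q, ω.IsInvariant ∧
      limsup Φ.pressure atTop ≤ specificEntropy ω - (ω.toLin Φ.energyObs).re := by
  classical
  obtain ⟨m, M, hmM⟩ := hΦ.exists_pressure_mem hd hr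
  obtain ⟨U, hU, hlim⟩ := exists_ultrafilter_tendsto_limsup hmM
  choose σ hσ using Φ.exists_gibbsState
  obtain ⟨ω, hω'⟩ := exists_state_tendsto U fun a =>
    if h : (box a).Nonempty then (σ a).average (box a) h else σ a
  have hω : ∀ A, Tendsto (fun a => ((box a).card : ℂ)⁻¹ *
      ∑ x ∈ box a, (σ a).toLin (translate x A)) U (nhds (ω.toLin A)) := by
    intro A
    refine (hω' A).congr' ?_
    filter_upwards [hU eventually_one_le] with a ha
    rw [dif_pos (Finset.card_pos.1 (card_box_pos ha)), State.average_apply]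
  have hinv := isInvariant_of_tendsto_average hU hω
  refine ⟨ω, hinv, ?_⟩
  have hE : Tendsto (fun a => ((σ a).marginal (box a) * Φ.hamiltonian (box a)).trace.re /
      ((box a).card : ℝ)) U (nhds (ω.toLin Φ.energyObs).re) := by
    have h := ((hΦ.tendsto_energy_sub hd hr σ).mono_left hU).add
      ((Complex.continuous_re.tendsto _).comp (hω Φ.energyObs))
    rw [zero_add] at h
    refine h.congr fun a => ?_
    simp
  -- In a Gibbs state entropy is pressure plus energy, both of which converge along `U`.
  have hS : Tendsto (fun a => entropy ((σ a).marginal (box a)) / ((box a).card : ℝ)) U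
      (nhds (limsup Φ.pressure atTop + (ω.toLin Φ.energyObs).re)) := by
    refine (hlim.add hE).congr fun a => ?_
    rw [Interaction.pressure_eq (hσ a), sub_add_cancel]
  rw [le_sub_iff_add_le]
  refine ge_of_tendsto (tendsto_entropy_density hinv) ?_
  filter_upwards [eventually_one_le] with b hb
  have hc : (0 : ℝ) < (box b).card := by exact_mod_cast card_box_pos hb
  rw [le_div_iff₀ hc, mul_comm]
  exact mul_card_le_entropy_marginal hU hω hS hb

/-- Nonnegativity of the relative entropy gives the bound in every box, and the left side converges.
-/
theorem Interaction.MemB.specificEntropy_sub_le [NeZero q] (hd : 1 ≤ d) (hr : 0 < r)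
    (hΦ : Φ.MemB r) {ρ : State d q} (hρ : ρ.IsInvariant) :
    specificEntropy ρ - (ρ.toLin Φ.energyObs).re ≤ limsup Φ.pressure atTop := by
  obtain ⟨m, M, hmM⟩ := hΦ.exists_pressure_mem hd hr
  have h := (tendsto_entropy_density hρ).sub (hΦ.tendsto_energy hd hr hρ)
  rw [← h.limsup_eq]
  refine limsup_le_limsup (.of_forall fun a => ?_) h.isCoboundedUnder_le
    (isBoundedUnder_of_eventually_le (hmM.mono fun _ h => h.2))
  have h1 := Φ.relEntropy_div_card ρ a
  have h2 : 0 ≤ relEntropy (ρ.marginal (box a)) (Φ.localGibbs (box a)) / ((box a).card : ℝ) :=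
    div_nonneg (relEntropy_gibbs_nonneg (ρ.posSemidef_marginal _) (ρ.trace_marginal _)
      (Φ.isHermitian_hamiltonian _)) (Nat.cast_nonneg _)
  linarith

theorem Interaction.MemB.exists_isEquilibrium [NeZero q] (hd : 1 ≤ d) (hr : 0 < r)
    (hΦ : Φ.MemB r) : ∃ ω : State d q, IsEquilibrium Φ ω := by
  obtain ⟨ω, hω, h⟩ := hΦ.exists_limsup_pressure_le hd hr
  exact ⟨ω, hω, fun ρ hρ => (hΦ.specificEntropy_sub_le hd hr hρ).trans h⟩

/-- The specific relative entropy of an equilibrium state vanishes. -/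
theorem Interaction.MemB.specificRelEntropy_le_zero [NeZero q] (hd : 1 ≤ d) (hr : 0 < r)
    (hΦ : Φ.MemB r) {ω : State d q} (hω : IsEquilibrium Φ ω) : specificRelEntropy ω Φ ≤ 0 := by
  obtain ⟨m, M, hmM⟩ := hΦ.exists_pressure_mem hd hr
  obtain ⟨ω', hω', h'⟩ := hΦ.exists_limsup_pressure_le hd hr
  -- An equilibrium state does at least as well as the constructed `ω'`, so it reaches the limsup of
  -- the pressure.
  have h1 := h'.trans (hω.2 ω' hω')
  have h2 := (tendsto_entropy_density hω.1).neg.add (hΦ.tendsto_energy hd hr hω.1)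
  have hb := isBoundedUnder_of_eventually_le (hmM.mono fun _ h => h.2)
  have hb' := isBoundedUnder_of_eventually_ge (hmM.mono fun _ h => h.1)
  have h3 : specificRelEntropy ω Φ ≤ -specificEntropy ω + (ω.toLin Φ.energyObs).re
      + limsup Φ.pressure atTop := by
    rw [← h2.limsup_eq]
    refine le_trans (le_of_eq ?_) (limsup_add_le h2.isBoundedUnder_ge h2.isBoundedUnder_le
      hb'.isCoboundedUnder_le hb)
    exact congrArg (fun u => limsup u atTop) (funext fun a => Φ.relEntropy_div_card ω a)
  linarith

/-! ### The `W₁` norm -/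

section W1

theorem traceSite_sub {ι : Type*} [DecidableEq ι] (x : ι)
    (A B : Matrix (ι → Fin q) (ι → Fin q) ℂ) :
    traceSite x (A - B) = traceSite x A - traceSite x B := by
  ext s t
  simp [traceSite, Finset.sum_sub_distrib]

variable {ι : Type*} [Fintype ι] [DecidableEq ι]

/-- Replacing the state of the spins in `S` by the maximally mixed one. -/
def depolarize (S : Finset ι) (A : Matrix (ι → Fin q) (ι → Fin q) ℂ) :
    Matrix (ι → Fin q) (ι → Fin q) ℂ :=
  Matrix.of fun s t => if ∀ x ∈ S, s x = t x then
    -- The sum runs over configurations of all sites, each choice on `S` being repeated equally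
    -- often, so the normalization does not depend on `S`.
    (Fintype.card (ι → Fin q) : ℂ)⁻¹ * ∑ u, A (S.piecewise u s) (S.piecewise u t) else 0

theorem depolarize_apply (S : Finset ι) (A : Matrix (ι → Fin q) (ι → Fin q) ℂ)
    (s t : ι → Fin q) : depolarize S A s t = if ∀ x ∈ S, s x = t x then
      (Fintype.card (ι → Fin q) : ℂ)⁻¹ * ∑ u, A (S.piecewise u s) (S.piecewise u t) else 0 := rfl

theorem card_config_ne_zero [NeZero q] : (Fintype.card (ι → Fin q) : ℂ) ≠ 0 := by
  have : Nonempty (ι → Fin q) := ⟨fun _ => 0⟩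
  exact_mod_cast Fintype.card_ne_zero

theorem depolarize_empty [NeZero q] (A : Matrix (ι → Fin q) (ι → Fin q) ℂ) :
    depolarize ∅ A = A := by
  ext s t
  rw [depolarize_apply, if_pos (by simp)]
  simp only [Finset.piecewise_empty, Finset.sum_const, nsmul_eq_mul, Finset.card_univ]
  rw [inv_mul_cancel_left₀ card_config_ne_zero]

theorem depolarize_univ (A : Matrix (ι → Fin q) (ι → Fin q) ℂ) (hA : A.trace = 0) :
    depolarize Finset.univ A = 0 := by
  ext s t
  rw [depolarize_apply]
  simp only [Finset.piecewise_univ]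
  have : ∑ u, A u u = 0 := hA
  rw [this]
  simp

theorem depolarize_sub (S : Finset ι) (A B : Matrix (ι → Fin q) (ι → Fin q) ℂ) :
    depolarize S (A - B) = depolarize S A - depolarize S B := by
  ext s t
  rw [Matrix.sub_apply, depolarize_apply, depolarize_apply, depolarize_apply]
  split_ifs
  · simp [Finset.sum_sub_distrib, mul_sub]
  · simp

/-- Exchanging the spins in `S` between `s` and `u` is an involution of pairs that turns the double
sum into a trace times a count. -/
theorem trace_depolarize [NeZero q] (S : Finset ι) (A : Matrix (ι → Fin q) (ι → Fin q) ℂ) :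
    (depolarize S A).trace = A.trace := by
  have h : ∑ s : ι → Fin q, ∑ u : ι → Fin q, A (S.piecewise u s) (S.piecewise u s)
      = Fintype.card (ι → Fin q) * A.trace := by
    rw [← Finset.sum_product', Finset.univ_product_univ]
    have : ∑ p : (ι → Fin q) × (ι → Fin q), A (S.piecewise p.2 p.1) (S.piecewise p.2 p.1)
        = ∑ p : (ι → Fin q) × (ι → Fin q), A p.1 p.1 := by
      refine Finset.sum_nbij' (fun p => (S.piecewise p.2 p.1, S.piecewise p.1 p.2))
        (fun p => (S.piecewise p.2 p.1, S.piecewise p.1 p.2)) (fun _ _ => Finset.mem_univ _)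
        (fun _ _ => Finset.mem_univ _) ?_ ?_ fun _ _ => rfl <;>
      · intro p _
        refine Prod.ext ?_ ?_ <;>
        · funext x
          by_cases hx : x ∈ S <;> simp [hx]
    rw [this, Fintype.sum_prod_type, Matrix.trace]
    simp [Finset.mul_sum]
  simp only [Matrix.trace, Matrix.diag, depolarize_apply, implies_true, if_true]
  rw [← Finset.mul_sum, h, inv_mul_cancel_left₀ card_config_ne_zero]
  rfl

/-- Schur product theorem: an average of submatrices of `A` is multiplied entrywise by the indicator
of agreement on `S`, itself a submatrix of an identity matrix. -/
theorem posSemidef_depolarize (S : Finset ι) {A : Matrix (ι → Fin q) (ι → Fin q) ℂ}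
    (hA : A.PosSemidef) : (depolarize S A).PosSemidef := by
  have h1 : (∑ u : ι → Fin q, A.submatrix (fun s : ι → Fin q => S.piecewise u s)
      (fun s => S.piecewise u s)).PosSemidef :=
    Matrix.posSemidef_sum _ fun u _ => hA.submatrix _
  have h2 : ((Fintype.card (ι → Fin q) : ℂ)⁻¹ •
      ∑ u : ι → Fin q, A.submatrix (fun s : ι → Fin q => S.piecewise u s)
        (fun s => S.piecewise u s)).PosSemidef :=
    h1.smul (inv_nonneg.2 (Nat.cast_nonneg _))
  have h3 : ((1 : Matrix (S → Fin q) (S → Fin q) ℂ).submatrix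
      (fun (s : ι → Fin q) (x : S) => s x) (fun s x => s x)).PosSemidef :=
    Matrix.PosSemidef.one.submatrix _
  have e : depolarize S A = Matrix.hadamard ((Fintype.card (ι → Fin q) : ℂ)⁻¹ •
      ∑ u : ι → Fin q, A.submatrix (fun s : ι → Fin q => S.piecewise u s) fun s => S.piecewise u s)
      ((1 : Matrix (S → Fin q) (S → Fin q) ℂ).submatrix
        (fun (s : ι → Fin q) (x : S) => s x) (fun s x => s x)) := by
    ext s t
    rw [depolarize_apply, Matrix.hadamard_apply, Matrix.submatrix_apply, Matrix.one_apply,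
      Matrix.smul_apply, Matrix.sum_apply, smul_eq_mul]
    have : (∀ x ∈ S, s x = t x) ↔ (fun x : S => s x) = fun x : S => t x := by
      rw [funext_iff, Subtype.forall]
    simp only [this]
    split_ifs <;> simp
  rw [e]
  exact h2.hadamard h3

theorem sum_update_eq (x : ι) (G : (ι → Fin q) → ℂ) :
    ∑ j : Fin q, ∑ u, G (Function.update u x j) = ∑ _ : Fin q, ∑ u, G u := by
  have h : ∑ p : Fin q × (ι → Fin q), G (Function.update p.2 x p.1)
      = ∑ p : Fin q × (ι → Fin q), G p.2 := by
    refine Finset.sum_nbij' (fun p => (p.2 x, Function.update p.2 x p.1))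
      (fun p => (p.2 x, Function.update p.2 x p.1)) (fun _ _ => Finset.mem_univ _)
      (fun _ _ => Finset.mem_univ _) ?_ ?_ fun _ _ => rfl <;>
    · intro p _
      simp
  simpa only [Fintype.sum_prod_type] using h

/-- Tracing out `x` forgets whether `x` has been depolarized. The sum over the spin at `x` and the
averaging over `u x` are exchanged by `sum_update_eq`. -/
theorem traceSite_depolarize_insert (S : Finset ι) {x : ι} (hx : x ∉ S)
    (A : Matrix (ι → Fin q) (ι → Fin q) ℂ) :
    traceSite x (depolarize (insert x S) A) = traceSite x (depolarize S A) := by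
  ext s t
  let e := fun (j : Fin q) (s : {y // y ≠ x} → Fin q) =>
    (Equiv.funSplitAt x (Fin q)).symm (j, s)
  have ex : ∀ j s, e j s x = j := fun j s => by simp [e, Equiv.funSplitAt, Equiv.piSplitAt]
  have ey : ∀ j s y (hy : y ≠ x), e j s y = s ⟨y, hy⟩ := fun j s y hy => by
    simp [e, Equiv.funSplitAt, Equiv.piSplitAt, hy]
  have hiff : ∀ j, (∀ y ∈ insert x S, e j s y = e j t y) ↔ ∀ y ∈ S, e j s y = e j t y := by
    intro j
    rw [Finset.forall_mem_insert, ex, ex]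
    simp
  have hindep : ∀ i j, (∀ y ∈ S, e i s y = e i t y) ↔ ∀ y ∈ S, e j s y = e j t y := by
    intro i j
    refine forall₂_congr fun y hy => ?_
    have hyx : y ≠ x := fun h => hx (h ▸ hy)
    rw [ey i s y hyx, ey i t y hyx, ey j s y hyx, ey j t y hyx]
  let G : (ι → Fin q) → ℂ := fun u => A (S.piecewise u (e (u x) s)) (S.piecewise u (e (u x) t))
  have h1 : ∀ (j : Fin q) s u, (insert x S).piecewise u (e j s) = S.piecewise u (e (u x) s) := by
    intro j s u
    funext y
    by_cases hyx : y = x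
    · subst hyx
      simp [hx, ex]
    · by_cases hy : y ∈ S
      · simp [hy]
      · rw [Finset.piecewise_eq_of_notMem _ _ _ (by simp [hy, hyx]),
          Finset.piecewise_eq_of_notMem _ _ _ hy, ey _ _ _ hyx, ey _ _ _ hyx]
  have h2 : ∀ j s u, S.piecewise u (e j s) = S.piecewise (Function.update u x j)
      (e (Function.update u x j x) s) := by
    intro j s u
    funext y
    by_cases hy : y ∈ S
    · have hyx : y ≠ x := fun h => hx (h ▸ hy)
      simp [hy, hyx]
    · simp [hy]
  change ∑ j, depolarize (insert x S) A (e j s) (e j t) = ∑ j, depolarize S A (e j s) (e j t)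
  simp only [depolarize_apply, hiff, h1]
  by_cases hP : ∀ j, ∀ y ∈ S, e j s y = e j t y
  · simp only [if_pos (hP _)]
    rw [← Finset.mul_sum, ← Finset.mul_sum]
    congr 1
    rw [← sum_update_eq x G]
    refine Finset.sum_congr rfl fun j _ => Finset.sum_congr rfl fun u _ => ?_
    rw [h2 j s u, h2 j t u]
  · have hP' : ∀ j, ¬ ∀ y ∈ S, e j s y = e j t y := fun j h => hP fun i => (hindep i j).2 h
    simp only [if_neg (hP' _)]

/-- Telescoping decomposition of the difference of two density matrices. -/
theorem exists_sum_eq_sub_depolarize [NeZero q] {R T : Matrix (ι → Fin q) (ι → Fin q) ℂ}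
    (hR : R.PosSemidef) (hT : T.PosSemidef) (hR1 : R.trace = 1) (hT1 : T.trace = 1)
    (S : Finset ι) : ∃ E : ι → Matrix (ι → Fin q) (ι → Fin q) ℂ,
      (∀ x, (E x).IsHermitian ∧ (E x).trace = 0 ∧ traceSite x (E x) = 0) ∧
      (∀ x, traceNorm (E x) ≤ 4) ∧ ∑ x ∈ S, E x = (R - T) - depolarize S (R - T) := by
  induction S using Finset.induction_on with
  | empty =>
    refine ⟨fun _ => 0, fun x => ⟨Matrix.isHermitian_zero, Matrix.trace_zero _ _, ?_⟩, fun x => ?_,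
      ?_⟩
    · ext s t
      simp [traceSite]
    · have := traceNorm_sub_le (Matrix.PosSemidef.zero (n := ι → Fin q) (R := ℂ))
        Matrix.PosSemidef.zero
      simp only [sub_zero, Matrix.trace_zero, Complex.zero_re, add_zero] at this
      linarith
    · rw [depolarize_empty, sub_self, Finset.sum_empty]
  | insert x S hx ih =>
    obtain ⟨E, hE, hE4, hsum⟩ := ih
    set F := depolarize S (R - T) - depolarize (insert x S) (R - T) with hF
    -- Regrouped as a difference of two positive matrices of trace two, whence the bound 4.
    have hF2 : F = (depolarize S R + depolarize (insert x S) T)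
        - (depolarize S T + depolarize (insert x S) R) := by
      rw [hF, depolarize_sub, depolarize_sub]
      abel
    have h1 := (posSemidef_depolarize S hR).add (posSemidef_depolarize (insert x S) hT)
    have h2 := (posSemidef_depolarize S hT).add (posSemidef_depolarize (insert x S) hR)
    refine ⟨Function.update E x F, fun y => ?_, fun y => ?_, ?_⟩
    · by_cases hy : y = x
      · subst hy
        rw [Function.update_self]
        refine ⟨?_, ?_, ?_⟩
        · rw [hF2]
          exact h1.1.sub h2.1
        · rw [hF, Matrix.trace_sub, trace_depolarize, trace_depolarize, sub_self]
        · rw [hF, traceSite_sub, traceSite_depolarize_insert S hx, sub_self]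
      · rw [Function.update_of_ne hy]
        exact hE y
    · by_cases hy : y = x
      · subst hy
        rw [Function.update_self, hF2]
        refine (traceNorm_sub_le h1 h2).trans ?_
        simp only [Matrix.trace_add, trace_depolarize, hR1, hT1, Complex.add_re, Complex.one_re]
        norm_num
      · rw [Function.update_of_ne hy]
        exact hE4 y
    · rw [Finset.sum_insert hx, Function.update_self]
      have : ∑ y ∈ S, Function.update E x F y = ∑ y ∈ S, E y :=
        Finset.sum_congr rfl fun y hy => Function.update_of_ne (ne_of_mem_of_not_mem hy hx) _ _
      rw [this, hsum, hF]
      abel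

theorem exists_W1_decomposition [NeZero q] {R T : Matrix (ι → Fin q) (ι → Fin q) ℂ}
    (hR : R.PosSemidef) (hT : T.PosSemidef) (hR1 : R.trace = 1) (hT1 : T.trace = 1) :
    ∃ E : ι → Matrix (ι → Fin q) (ι → Fin q) ℂ,
      (∀ x, (E x).IsHermitian ∧ (E x).trace = 0 ∧ traceSite x (E x) = 0) ∧
      (∀ x, traceNorm (E x) ≤ 4) ∧ ∑ x, E x = R - T := by
  obtain ⟨E, h1, h2, h3⟩ := exists_sum_eq_sub_depolarize hR hT hR1 hT1 Finset.univ
  rw [depolarize_univ _ (by rw [Matrix.trace_sub, hR1, hT1, sub_self]), sub_zero] at h3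
  exact ⟨E, h1, h2, h3⟩

theorem W1norm_nonneg (D : Matrix (ι → Fin q) (ι → Fin q) ℂ) : 0 ≤ W1norm D := by
  refine Real.sInf_nonneg ?_
  rintro _ ⟨E, hE, -, rfl⟩
  exact mul_nonneg (by norm_num) (Finset.sum_nonneg fun x _ => traceNorm_nonneg (hE x).1)

theorem W1norm_sub_le [NeZero q] {R T : Matrix (ι → Fin q) (ι → Fin q) ℂ}
    (hR : R.PosSemidef) (hT : T.PosSemidef) (hR1 : R.trace = 1) (hT1 : T.trace = 1) :
    W1norm (R - T) ≤ 2 * Fintype.card ι := by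
  obtain ⟨E, h1, h2, h3⟩ := exists_W1_decomposition hR hT hR1 hT1
  rw [W1norm]
  refine le_trans (csInf_le (a := (1 / 2) * ∑ x, traceNorm (E x)) ?_ ⟨E, h1, h3, rfl⟩) ?_
  · refine ⟨0, ?_⟩
    rintro _ ⟨E, hE, -, rfl⟩
    exact mul_nonneg (by norm_num) (Finset.sum_nonneg fun x _ => traceNorm_nonneg (hE x).1)
  · have := Finset.sum_le_card_nsmul Finset.univ _ _ fun x _ => h2 x
    rw [nsmul_eq_mul, Finset.card_univ] at this
    linarith

/-- Duality between the `W₁` norm and the oscillation of observables. -/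
theorem norm_trace_mul_le_W1norm [NeZero q] {R T : Matrix (ι → Fin q) (ι → Fin q) ℂ}
    (hR : R.PosSemidef) (hT : T.PosSemidef) (hR1 : R.trace = 1) (hT1 : T.trace = 1)
    (A : Matrix (ι → Fin q) (ι → Fin q) ℂ) {C : ℝ} (hC : 0 ≤ C)
    (hA : ∀ (x : ι) (E : Matrix (ι → Fin q) (ι → Fin q) ℂ), E.IsHermitian → traceSite x E = 0 →
      ‖(E * A).trace‖ ≤ C * traceNorm E) :
    ‖((R - T) * A).trace‖ ≤ 2 * C * W1norm (R - T) := by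
  -- The infimum of the empty set is `0` in `ℝ`, so the bound needs an admissible decomposition to
  -- exist.
  obtain ⟨E₀, h1, -, h3⟩ := exists_W1_decomposition hR hT hR1 hT1
  have key : ∀ w ∈ {w : ℝ | ∃ E : ι → Matrix (ι → Fin q) (ι → Fin q) ℂ,
      (∀ x, (E x).IsHermitian ∧ (E x).trace = 0 ∧ traceSite x (E x) = 0) ∧
      ∑ x, E x = R - T ∧ w = (1 / 2) * ∑ x, traceNorm (E x)},
      ‖((R - T) * A).trace‖ ≤ 2 * C * w := by
    rintro _ ⟨E, hE, hsum, rfl⟩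
    rw [← hsum, Finset.sum_mul, Matrix.trace_sum]
    refine (norm_sum_le_of_le _ fun x _ => hA x (E x) (hE x).1 (hE x).2.2).trans (le_of_eq ?_)
    rw [← Finset.mul_sum]
    ring
  rcases hC.eq_or_lt with rfl | hC
  · simpa using key _ ⟨E₀, h1, h3, rfl⟩
  · rw [mul_comm, ← div_le_iff₀ (by positivity)]
    refine le_csInf ⟨_, E₀, h1, h3, rfl⟩ fun w hw => ?_
    rw [div_le_iff₀ (by positivity), mul_comm]
    exact key w hw

end W1

/-- The observable acts trivially at `x`, so the trace factors through the partial trace of `E` over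
`x`. -/
theorem trace_mul_incl_eq_zero {Y Λ : Finset (Site d)} (hY : Y ⊆ Λ) {x : Λ} (hx : x.1 ∉ Y)
    {E : LocalObs d q Λ} (hE : traceSite x E = 0) (A : LocalObs d q Y) :
    (E * incl hY A).trace = 0 := by
  let e := fun (j : Fin q) (s : {y // y ≠ x} → Fin q) =>
    (Equiv.funSplitAt x (Fin q)).symm (j, s)
  have ex : ∀ j s, e j s x = j := fun j s => by simp [e, Equiv.funSplitAt, Equiv.piSplitAt]
  have ey : ∀ j s y (hy : y ≠ x), e j s y = s ⟨y, hy⟩ := fun j s y hy => by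
    simp [e, Equiv.funSplitAt, Equiv.piSplitAt, hy]
  have hsum : ∀ f : (Λ → Fin q) → ℂ, ∑ s, f s = ∑ s', ∑ j, f (e j s') := by
    intro f
    rw [Finset.sum_comm, ← Fintype.sum_prod_type' fun j s' => f (e j s')]
    exact ((Equiv.funSplitAt x (Fin q)).symm.sum_comp f).symm
  have h0 : ∀ s' t', ∑ j, E (e j s') (e j t') = 0 := fun s' t' => congrFun (congrFun hE s') t'
  by_cases hq : Nonempty (Fin q)
  swap
  · rw [not_nonempty_iff] at hq
    have : IsEmpty (Λ → Fin q) := ⟨fun s => hq.elim (s x)⟩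
    simp [Matrix.trace]
  obtain ⟨j₀⟩ := hq
  have hincl : ∀ i j s' t', incl hY A (e j t') (e i s')
      = if i = j then incl hY A (e j₀ t') (e j₀ s') else 0 := by
    intro i j s' t'
    split_ifs with hij
    · subst hij
      have hne : ∀ y (h : y ∈ Y), (⟨y, hY h⟩ : Λ) ≠ x := fun y h h' => hx (by rw [← h']; exact h)
      have hiff : (∀ y : Λ, y.1 ∉ Y → e i t' y = e i s' y) ↔
          ∀ y : Λ, y.1 ∉ Y → e j₀ t' y = e j₀ s' y := by
        refine forall₂_congr fun y _ => ?_
        by_cases hyx : y = x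
        · rw [hyx, ex, ex, ex, ex]
          simp
        · rw [ey _ _ _ hyx, ey _ _ _ hyx, ey _ _ _ hyx, ey _ _ _ hyx]
      have hres : ∀ u : {y // y ≠ x} → Fin q, (fun y : Y => e i u ⟨y.1, hY y.2⟩)
          = fun y : Y => e j₀ u ⟨y.1, hY y.2⟩ := by
        intro u
        funext y
        rw [ey _ _ _ (hne y.1 y.2), ey _ _ _ (hne y.1 y.2)]
      simp only [incl, Matrix.of_apply, hres]
      exact if_congr hiff rfl rfl
    · refine if_neg fun h => hij ?_
      have := h x hx
      rw [ex, ex] at this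
      exact this.symm
  simp only [Matrix.trace, Matrix.diag, Matrix.mul_apply]
  rw [hsum]
  refine Finset.sum_eq_zero fun s' _ => ?_
  have : ∀ i, ∑ t, E (e i s') t * incl hY A t (e i s')
      = ∑ t', E (e i s') (e i t') * incl hY A (e j₀ t') (e j₀ s') := by
    intro i
    rw [hsum]
    refine Finset.sum_congr rfl fun t' _ => ?_
    rw [Finset.sum_eq_single i]
    · rw [hincl i i, if_pos rfl]
    · intro j _ hj
      rw [hincl i j, if_neg hj.symm, mul_zero]
    · simp
  simp only [this]
  rw [Finset.sum_comm]
  refine Finset.sum_eq_zero fun t' _ => ?_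
  rw [← Finset.sum_mul, h0, zero_mul]

/-! ### Spatial averages and uniqueness of the `w₁`-Gibbs state -/

/-- The sum of the translates of a local observable that fit into the box. -/
def boxSum (a : Fin d → ℕ) {X : Finset (Site d)} (A : LocalObs d q X) : LocalObs d q (box a) :=
  ∑ z ∈ box a, if h : shiftRegion z X ⊆ box a then incl h (shiftObs z A) else 0

/-- Translates that miss `x` contribute nothing, and at most `|X|` translates cover it; the bound
does not grow with the box. -/
theorem norm_trace_mul_boxSum_le [NeZero q] (a : Fin d → ℕ) {X : Finset (Site d)}
    (A : LocalObs d q X) (x : box a) {E : LocalObs d q (box a)} (hE : E.IsHermitian)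
    (hx : traceSite x E = 0) :
    ‖(E * boxSum a A).trace‖ ≤ (X.card * opNorm A) * traceNorm E := by
  have h1 : ∀ z ∈ box a, ‖(E * (if h : shiftRegion z X ⊆ box a then incl h (shiftObs z A)
      else 0)).trace‖ ≤ if x.1 ∈ shiftRegion z X then opNorm A * traceNorm E else 0 := by
    intro z _
    have hnn : 0 ≤ opNorm A * traceNorm E := mul_nonneg (opNorm_nonneg A) (traceNorm_nonneg hE)
    by_cases h : shiftRegion z X ⊆ box a
    · rw [dif_pos h]
      split_ifs with hxz
      · refine (norm_trace_mul_le hE _).trans ?_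
        rw [mul_comm]
        refine mul_le_mul_of_nonneg_right ?_ (traceNorm_nonneg hE)
        change opNorm _ ≤ _
        rw [opNorm_incl]
        exact opNorm_shiftObs_le z A
      · rw [trace_mul_incl_eq_zero h hxz hx, norm_zero]
    · rw [dif_neg h, mul_zero, Matrix.trace_zero, norm_zero]
      split_ifs
      exacts [hnn, le_rfl]
  rw [boxSum, Finset.mul_sum, Matrix.trace_sum]
  refine (norm_sum_le_of_le _ h1).trans ?_
  rw [← Finset.sum_filter, Finset.sum_const, nsmul_eq_mul, mul_assoc]
  refine mul_le_mul_of_nonneg_right ?_ (mul_nonneg (opNorm_nonneg A) (traceNorm_nonneg hE))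
  have : ((box a).filter fun z => x.1 ∈ shiftRegion z X).card ≤ X.card := by
    refine Finset.card_le_card_of_injOn (fun z => x.1 - z) ?_ ?_
    · intro z hz
      exact mem_shiftRegion.1 (Finset.mem_filter.1 hz).2
    · intro z _ z' _ h
      exact sub_right_injective h
  exact_mod_cast this

theorem trace_marginal_mul_boxSum [NeZero q] {ρ : State d q} (hρ : ρ.IsInvariant)
    (a : Fin d → ℕ) {X : Finset (Site d)} (A : LocalObs d q X) :
    (ρ.marginal (box a) * boxSum a A).trace
      = (((box a).card : ℂ) - (overlap a X).card) * ρ.toLin (toQL A) := by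
  have hcard : (((box a).filter fun z => shiftRegion z X ⊆ box a).card : ℂ)
      = ((box a).card : ℂ) - (overlap a X).card := by
    rw [eq_sub_iff_add_eq]
    exact_mod_cast Finset.card_filter_add_card_filter_not (s := box a) _
  rw [boxSum, Finset.mul_sum, Matrix.trace_sum, ← hcard, ← nsmul_eq_mul, ← Finset.sum_const,
    Finset.sum_filter]
  refine Finset.sum_congr rfl fun z _ => ?_
  split_ifs with h
  · rw [ρ.trace_marginal_mul_incl, ← translate_toQL, hρ]
  · rw [mul_zero, Matrix.trace_zero]

/-- The a priori bound 2 on the density makes the limsup genuine, so `w₁ = 0` together with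
nonnegativity is convergence to zero. -/
theorem IsW1Gibbs.tendsto_W1norm [NeZero q] {Φ : Interaction d q} {ρ : State d q}
    (hρ : IsW1Gibbs Φ ρ) : Tendsto (fun a : Fin d → ℕ =>
      W1norm (ρ.marginal (box a) - Φ.localGibbs (box a)) / ((box a).card : ℝ)) atTop (nhds 0) := by
  have h0 : ∀ a : Fin d → ℕ, 0 ≤
      W1norm (ρ.marginal (box a) - Φ.localGibbs (box a)) / ((box a).card : ℝ) :=
    fun a => div_nonneg (W1norm_nonneg _) (Nat.cast_nonneg _)
  have h2 : ∀ a : Fin d → ℕ,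
      W1norm (ρ.marginal (box a) - Φ.localGibbs (box a)) / ((box a).card : ℝ) ≤ 2 := by
    intro a
    refine div_le_of_le_mul₀ (Nat.cast_nonneg _) zero_le_two ?_
    have := W1norm_sub_le (ρ.posSemidef_marginal (box a))
      (posSemidef_gibbs (Φ.isHermitian_hamiltonian (box a))) (ρ.trace_marginal (box a))
      (trace_gibbs (Φ.isHermitian_hamiltonian (box a)))
    rwa [Fintype.card_coe] at this
  have hb' := isBoundedUnder_of_eventually_ge (f := (atTop : Filter (Fin d → ℕ))) (.of_forall h0)
  exact tendsto_of_le_liminf_of_limsup_le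
    (le_liminf_of_le (isBoundedUnder_of_eventually_le (.of_forall h2)).isCoboundedUnder_ge
      (.of_forall h0)) hρ.2.le (isBoundedUnder_of_eventually_le (.of_forall h2)) hb'

/-- The expectations in a `w₁`-Gibbs state are limits of spatial averages in the local Gibbs
states. -/
theorem IsW1Gibbs.tendsto_localGibbs [NeZero q] {Φ : Interaction d q} {ρ : State d q}
    (hρ : IsW1Gibbs Φ ρ) {X : Finset (Site d)} (A : LocalObs d q X) :
    Tendsto (fun a : Fin d → ℕ => (Φ.localGibbs (box a) * boxSum a A).trace / ((box a).card : ℂ))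
      atTop (nhds (ρ.toLin (toQL A))) := by
  have h1 : Tendsto (fun a : Fin d → ℕ => ((ρ.marginal (box a) - Φ.localGibbs (box a)) *
      boxSum a A).trace / ((box a).card : ℂ)) atTop (nhds 0) := by
    have h := hρ.tendsto_W1norm.const_mul (2 * (X.card * opNorm A))
    rw [mul_zero] at h
    refine squeeze_zero_norm (fun a => ?_) h
    rw [norm_div, Complex.norm_natCast, ← mul_div_assoc]
    refine div_le_div_of_nonneg_right ?_ (Nat.cast_nonneg _)
    exact norm_trace_mul_le_W1norm (ρ.posSemidef_marginal (box a))
      (posSemidef_gibbs (Φ.isHermitian_hamiltonian (box a))) (ρ.trace_marginal (box a))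
      (trace_gibbs (Φ.isHermitian_hamiltonian (box a))) _
      (mul_nonneg (Nat.cast_nonneg _) (opNorm_nonneg A))
      fun x E hE hx => norm_trace_mul_boxSum_le a A x hE hx
  -- By invariance each translate that fits contributes exactly `ρ(A)`; the fraction that does not
  -- fit tends to zero.
  have h2 : Tendsto (fun a : Fin d → ℕ => (1 - (((overlap a X).card : ℝ) / ((box a).card : ℝ) : ℝ))
      * ρ.toLin (toQL A)) atTop (nhds ((1 - ((0 : ℝ) : ℂ)) * ρ.toLin (toQL A))) :=
    (((Complex.continuous_ofReal.tendsto _).comp (tendsto_card_overlap X)).const_sub 1).mul_const _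
  rw [Complex.ofReal_zero, sub_zero, one_mul] at h2
  have h3 := h2.sub h1
  rw [sub_zero] at h3
  refine h3.congr' ?_
  filter_upwards [eventually_one_le] with a ha
  have hc : ((box a).card : ℂ) ≠ 0 := by exact_mod_cast (card_box_pos ha).ne'
  rw [sub_mul (ρ.marginal (box a)), Matrix.trace_sub, trace_marginal_mul_boxSum hρ.1]
  push_cast
  field_simp
  ring

/-- Both states are limits of the same averages in the local Gibbs states. -/
theorem IsW1Gibbs.unique [NeZero q] {Φ : Interaction d q} {ρ σ : State d q}
    (hρ : IsW1Gibbs Φ ρ) (hσ : IsW1Gibbs Φ σ) : ρ = σ :=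
  State.ext_of_toQL fun _ A =>
    tendsto_nhds_unique (hρ.tendsto_localGibbs A) (hσ.tendsto_localGibbs A)

theorem IsEquilibrium.isW1Gibbs [NeZero q] {Φ : Interaction d q} {r c : ℝ} (hd : 1 ≤ d)
    (hr : 0 < r) (hΦ : Φ.MemB r) (hc : 0 < c) (hTCI : SatisfiesTCI Φ c) {ω : State d q}
    (hω : IsEquilibrium Φ ω) : IsW1Gibbs Φ ω := by
  refine ⟨hω.1, ?_⟩
  have h1 := hTCI ω hω.1
  have h2 := hΦ.specificRelEntropy_le_zero hd hr hω
  have h3 : c / 2 * specificRelEntropy ω Φ ≤ 0 := mul_nonpos_of_nonneg_of_nonpos (by positivity) h2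
  exact pow_eq_zero_iff two_ne_zero |>.1 (le_antisymm (h1.trans h3) (sq_nonneg _))

end QuantumSpin

end

/-! ### Assembly of the proposition -/

theorem mainTheorem10 (d q : ℕ) (hd : 1 ≤ d) (hq : 1 ≤ q) (r : ℝ) (hr : 0 < r)
    (Φ : QuantumSpin.Interaction d q) (hΦ : Φ.MemB r)
    (c : ℝ) (hc : 0 < c) (hTCI : QuantumSpin.SatisfiesTCI Φ c) :
    ∃ ω : QuantumSpin.State d q,
      QuantumSpin.IsEquilibrium Φ ω ∧
      (∀ ρ : QuantumSpin.State d q, QuantumSpin.IsEquilibrium Φ ρ → ρ = ω) ∧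
      QuantumSpin.IsW1Gibbs Φ ω ∧
      (∀ ρ : QuantumSpin.State d q, QuantumSpin.IsW1Gibbs Φ ρ → ρ = ω) := by
  have : NeZero q := ⟨by omega⟩
  obtain ⟨ω, hω⟩ := hΦ.exists_isEquilibrium hd hr
  have hW := hω.isW1Gibbs hd hr hΦ hc hTCI
  exact ⟨ω, hω, fun ρ hρ => (hρ.isW1Gibbs hd hr hΦ hc hTCI).unique hW, hW,
    fun ρ hρ => hρ.unique hW⟩
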